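/- Let $\Omega\subseteq\mathbb R^2$ be an open set containing $(0,0)$ and let $X=P\,\partial_u+Q\,\partial_v$ be a real-analytic vector field on $\Omega$ with $X(0,0)=(0,0)$ and $P_u(0,0)Q_v(0,0)-P_v(0,0)Q_u(0,0)>0$. Suppose that $X$ is reversible with respect to $R(u,v)=(u,-v)$, that is, $R(X(q))=-X(R(q))$ for all $q\in\Omega$ with $R(q)\in\Omega$. Then there are an open set $I\subseteq\mathbb R$ containing $0$ and a real-analytic function $V:I\to\mathbb R$ with $V(0)=V'(0)=0$ and $V''(0)>0$ such that $X$ is analytically conjugate near the origin to the vector field $Y=y\,\partial_x-V'(x)\,\partial_y$ on $I\times\mathbb R$. This means: there are open neighborhoods $U\subseteq\Omega$ and $W\subseteq I\times\mathbb R$ of $(0,0)$ and a bijection $h:U\to W$ with $h(0,0)=(0,0)$, real-analytic together with its inverse, such that $D_qh\,(X(q))=Y(h(q))$ for every $q\in U$. -/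

import Mathlib

open Set

/-- A linear involution of the plane: a linear map `R` with `R ≠ id` and `R ∘ R = id`. -/
def IsLinearInvolution (R : (ℝ × ℝ) →ₗ[ℝ] (ℝ × ℝ)) : Prop :=
  R ≠ LinearMap.id ∧ R ∘ₗ R = LinearMap.id

/-- The linear map `R(u, v) = (u, -v)`. -/
def reflectionR : (ℝ × ℝ) →ₗ[ℝ] (ℝ × ℝ) :=
  LinearMap.prod (LinearMap.fst ℝ ℝ ℝ) (-LinearMap.snd ℝ ℝ ℝ)

theorem reflectionR_apply (q : ℝ × ℝ) : reflectionR q = (q.1, -q.2) := rfl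

theorem isLinearInvolution_reflectionR : IsLinearInvolution reflectionR := by
  refine ⟨fun h => ?_, ?_⟩
  · have h1 := congrArg Prod.snd (LinearMap.congr_fun h ((0, 1) : ℝ × ℝ))
    norm_num [reflectionR_apply] at h1
  · refine LinearMap.ext fun q => ?_
    simp [reflectionR_apply]

/-- The vector field `X` on `Ω` is `R`-reversible: `R (X q) = - X (R q)` for all `q ∈ Ω`.
The domain `Ω` is not assumed to be `R`-invariant; the identity is required exactly where both
of its sides are values of the vector field on `Ω`. -/
def IsReversibleOn (R : (ℝ × ℝ) →ₗ[ℝ] (ℝ × ℝ)) (X : ℝ × ℝ → ℝ × ℝ) (Ω : Set (ℝ × ℝ)) : Prop :=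
  ∀ q ∈ Ω, R q ∈ Ω → R (X q) = -X (R q)

/-- The Jacobian determinant `P_x Q_y - P_y Q_x` at `p` of the vector field `X = (P, Q)`. -/
noncomputable def jacobianDet (X : ℝ × ℝ → ℝ × ℝ) (p : ℝ × ℝ) : ℝ :=
  (fderiv ℝ X p (1, 0)).1 * (fderiv ℝ X p (0, 1)).2
    - (fderiv ℝ X p (0, 1)).1 * (fderiv ℝ X p (1, 0)).2

/-- The vector field `y ∂/∂x - V'(x) ∂/∂y`. -/
noncomputable def potentialField (V : ℝ → ℝ) : ℝ × ℝ → ℝ × ℝ :=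
  fun q => (q.2, -deriv V q.1)

/-- `h` is an analytic diffeomorphism of the open set `h.source` onto the open set `h.target`
with `D_q h (X q) = Y (h q)` for all `q` in its source. -/
structure IsAnalyticConjugacy (h : OpenPartialHomeomorph (ℝ × ℝ) (ℝ × ℝ))
    (X Y : ℝ × ℝ → ℝ × ℝ) : Prop where
  analytic : AnalyticOnNhd ℝ h h.source
  analytic_symm : AnalyticOnNhd ℝ h.symm h.target
  conj : ∀ q ∈ h.source, fderiv ℝ h q (X q) = Y (h q)

/-- The vector field `X` on `Ω` is analytically conjugate near `(0,0)` to the vector field `Y`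
on `Ω'`: an analytic diffeomorphism `h` from an open neighbourhood of `(0,0)` in `Ω` onto an open
neighbourhood of `(0,0)` in `Ω'`, with `h(0,0) = (0,0)`, conjugates `X` to `Y`. -/
def AnalyticallyConjugateNearZero (X : ℝ × ℝ → ℝ × ℝ) (Ω : Set (ℝ × ℝ))
    (Y : ℝ × ℝ → ℝ × ℝ) (Ω' : Set (ℝ × ℝ)) : Prop :=
  ∃ h : OpenPartialHomeomorph (ℝ × ℝ) (ℝ × ℝ),
    (0, 0) ∈ h.source ∧ h (0, 0) = (0, 0) ∧ h.source ⊆ Ω ∧ h.target ⊆ Ω' ∧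
      IsAnalyticConjugacy h X Y

/-!
A field reversible under `(u, v) ↦ (u, -v)` has the form `(v p(u, v²), q(u, v²))`. Away from
`v = 0` its orbits project under the fold `w = v²` to integral curves of the field `p ∂/∂u + 2 q ∂/∂w`,
which does not vanish at the origin and therefore has an analytic first integral `C(u, w)`. The
sign of the Jacobian makes `C = u² A(u) + w B(u, w)` with `A` and `B` positive, so in the
coordinates `(u √A, v √B)` the function `C(u, v²)` is the squared radius and the field is `1 / m`
times the rotation field (`exists_orbital_normal_form`).

Rotating each circle into itself by a suitable variable angle replaces `m` by its mean `rotAvg m`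
over circles; the angle solves a cohomological equation over the rotation flow, for which there is
an explicit integral formula (`AnalyticAt.exists_twist`, `exists_circular_normal_form`). The
resulting field depends only on the period function of the centre. The same reduction applies to
the potential field of `V = E² / 2`: in the coordinates `(E(x), y)` it is `1 / n` times the
rotation field, where `E' = 1 / n(E)` (`AnalyticAt.exists_potential`). It remains to choose `n`, a
function of the first coordinate, with the same circular means as `m`. This is an Abel-type
equation, solved by dividing the Taylor coefficients of the mean of `m` by the means of the powers
of the cosine (`AnalyticAt.exists_rotAvg_fst_eq`).

Analytic dependence on parameters, both of integrals and of solutions of differential equations,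
rests on the analyticity of superposition operators on spaces of continuous functions
(`AnalyticAt.exists_superposition`); for differential equations it is combined with the analytic
implicit function theorem (`AnalyticAt.exists_integral_flow`).
-/

open Filter Topology

/-! ### Superposition operators and parametric integrals -/

/-- Superposition with an analytic map `F` is an analytic map between spaces of continuous
functions: its Taylor series at `0` is obtained by applying that of `F` pointwise. -/
theorem AnalyticAt.exists_superposition (K : Type*) [TopologicalSpace K] [CompactSpace K]
    {E G : Type*} [NormedAddCommGroup E] [NormedSpace ℝ E] [NormedAddCommGroup G]
    [NormedSpace ℝ G] [CompleteSpace G] {F : E → G} (hF : AnalyticAt ℝ F 0) :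
    ∃ N : C(K, E) → C(K, G), AnalyticAt ℝ N 0 ∧ ∀ᶠ y in 𝓝 0, ∀ t, N y t = F (y t) := by
  obtain ⟨p, r, hp⟩ := hF
  let P : FormalMultilinearSeries ℝ C(K, E) C(K, G) := fun n =>
    MultilinearMap.mkContinuous
      { toFun := fun y => ⟨fun t => p n (fun i => y i t), by
          have := (p n).cont
          fun_prop⟩
        map_update_add' := by
          intro _ y i a b
          ext t
          have key : ∀ c : C(K, E), (fun j => (Function.update y i c) j t)
              = Function.update (fun j => y j t) i (c t) := by
            intro c
            ext j
            by_cases h : j = i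
            · subst h; simp
            · simp [h]
          simp only [ContinuousMap.coe_mk, ContinuousMap.add_apply, key]
          exact (p n).map_update_add _ _ _ _
        map_update_smul' := by
          intro _ y i a b
          ext t
          have key : ∀ c : C(K, E), (fun j => (Function.update y i c) j t)
              = Function.update (fun j => y j t) i (c t) := by
            intro c
            ext j
            by_cases h : j = i
            · subst h; simp
            · simp [h]
          simp only [ContinuousMap.coe_mk, ContinuousMap.smul_apply, key]
          exact (p n).map_update_smul _ _ _ _ } ‖p n‖ (by
      intro y
      refine (ContinuousMap.norm_le _ (by positivity)).2 fun t => ?_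
      refine ((p n).le_opNorm _).trans ?_
      gcongr with i
      exact (y i).norm_coe_le_norm t)
  have hPa : ∀ n (y : C(K, E)) t, P n (fun _ => y) t = p n (fun _ => y t) := fun n y t => rfl
  have hPn : ∀ n, ‖P n‖ ≤ ‖p n‖ := fun n =>
    MultilinearMap.mkContinuous_norm_le _ (norm_nonneg _) _
  have hrad : p.radius ≤ P.radius := FormalMultilinearSeries.radius_le_of_le hPn
  have hpos : 0 < P.radius := (hp.r_pos.trans_le hp.r_le).trans_le hrad
  have hPs := P.hasFPowerSeriesOnBall hpos
  refine ⟨P.sum, hPs.analyticAt, ?_⟩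
  filter_upwards [Metric.eball_mem_nhds (0 : C(K, E)) hp.r_pos] with y hy t
  have hs := hPs.hasSum (y := y) (Metric.eball_subset_eball (hp.r_le.trans hrad) hy)
  have hs' := ((ContinuousMap.evalCLM ℝ t : C(K, G) →L[ℝ] G)).hasSum hs
  have hy' : y t ∈ Metric.eball (0 : E) r := by
    rw [Metric.mem_eball, edist_zero_right] at hy ⊢
    refine lt_of_le_of_lt ?_ hy
    simpa [enorm_le_iff_norm_le] using y.norm_coe_le_norm t
  have h2 := hp.hasSum hy'
  simp only [zero_add] at h2 hs'
  exact hs'.unique h2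

theorem AnalyticAt.fderiv_apply_const {E G : Type*} [NormedAddCommGroup E] [NormedSpace ℝ E]
    [NormedAddCommGroup G] [NormedSpace ℝ G] [CompleteSpace G] {f : E → G} {x : E}
    (hf : AnalyticAt ℝ f x) (v : E) : AnalyticAt ℝ (fun y => fderiv ℝ f y v) x :=
  ((ContinuousLinearMap.apply ℝ G v).analyticAt _).fun_comp hf.fderiv

theorem AnalyticAt.intervalIntegral_comp_clm {E E' : Type*} [NormedAddCommGroup E]
    [NormedSpace ℝ E] [NormedAddCommGroup E'] [NormedSpace ℝ E'] {F : E → ℝ}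
    (hF : AnalyticAt ℝ F 0) {A : ℝ → E' →L[ℝ] E} (hA : Continuous A) {k : ℝ → ℝ}
    (hk : Continuous k) {a b : ℝ} (hab : a ≤ b) :
    AnalyticAt ℝ (fun q => ∫ t in a..b, k t * F (A t q)) 0 := by
  obtain ⟨N, hN, hNF⟩ := hF.exists_superposition (Icc a b)
  obtain ⟨M, hM⟩ := isCompact_Icc.exists_bound_of_continuousOn (s := Icc a b) hA.continuousOn
  obtain ⟨M', hM'⟩ := isCompact_Icc.exists_bound_of_continuousOn (s := Icc a b) hk.continuousOn
  have hM0 : 0 ≤ M := (norm_nonneg _).trans (hM a ⟨le_rfl, hab⟩)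
  have hM0' : 0 ≤ M' := (norm_nonneg _).trans (hM' a ⟨le_rfl, hab⟩)
  let Λ : E' →L[ℝ] C(Icc a b, E) := LinearMap.mkContinuous
    { toFun := fun q => ⟨fun t => A t q, by fun_prop⟩
      map_add' := fun x y => by ext; simp
      map_smul' := fun c x => by ext; simp } M (by
    intro q
    refine (ContinuousMap.norm_le _ (by positivity)).2 fun t => ?_
    exact (A t).le_of_opNorm_le (hM t t.2) q)
  let J : C(Icc a b, ℝ) →L[ℝ] ℝ := LinearMap.mkContinuous
    { toFun := fun y => ∫ t in a..b, k t * y (projIcc a b hab t)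
      map_add' := fun x y => by
        rw [← intervalIntegral.integral_add]
        · simp [mul_add]
        all_goals
          refine Continuous.intervalIntegrable ?_ _ _
          have := continuous_projIcc (h := hab)
          fun_prop
      map_smul' := fun c x => by
        rw [RingHom.id_apply, ← intervalIntegral.integral_smul]
        simp [mul_left_comm] } (M' * |b - a|) (by
    intro y
    have := intervalIntegral.norm_integral_le_of_norm_le_const (a := a) (b := b)
      (f := fun t => k t * y (projIcc a b hab t)) (C := M' * ‖y‖) (by
        intro t ht
        rw [norm_mul]
        rw [uIoc_of_le hab] at ht
        exact mul_le_mul (hM' t ⟨ht.1.le, ht.2⟩) (y.norm_coe_le_norm _) (norm_nonneg _) hM0')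
    simp only [LinearMap.coe_mk, AddHom.coe_mk]
    calc _ ≤ _ := this
      _ = _ := by ring)
  have h1 : AnalyticAt ℝ (fun q => J (N (Λ q))) 0 := by
    have hΛ : AnalyticAt ℝ (fun q => Λ q) 0 := Λ.analyticAt 0
    have h2 : AnalyticAt ℝ (fun q => N (Λ q)) 0 :=
      AnalyticAt.fun_comp (g := N) (by simpa using hN) hΛ
    exact (J.analyticAt _).fun_comp h2
  refine h1.congr ?_
  have hΛ0 : Tendsto Λ (𝓝 0) (𝓝 0) := by simpa using Λ.continuous.tendsto 0
  filter_upwards [hΛ0.eventually hNF] with q hq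
  change ∫ t in a..b, k t * N (Λ q) (projIcc a b hab t) = _
  refine intervalIntegral.integral_congr fun t ht => ?_
  rw [uIcc_of_le hab] at ht
  simp only [hq]
  rw [projIcc_of_mem hab ht]
  rfl

/-- Hadamard's lemma: the difference quotient of `f` in the direction `v` is analytic, being the
mean of `∂f/∂v` over the segment from `(u, 0)` to `(u, v)`. -/
theorem AnalyticAt.exists_eq_add_snd_mul {f : ℝ × ℝ → ℝ} (hf : AnalyticAt ℝ f 0) :
    ∃ g : ℝ × ℝ → ℝ, AnalyticAt ℝ g 0 ∧ ∀ᶠ q in 𝓝 (0 : ℝ × ℝ), f q = f (q.1, 0) + q.2 * g q := by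
  let A : ℝ → (ℝ × ℝ) →L[ℝ] (ℝ × ℝ) := fun s =>
    (ContinuousLinearMap.inl ℝ ℝ ℝ).comp (ContinuousLinearMap.fst ℝ ℝ ℝ) +
      s • (ContinuousLinearMap.inr ℝ ℝ ℝ).comp (ContinuousLinearMap.snd ℝ ℝ ℝ)
  have hA : Continuous A := by fun_prop
  have hAa : ∀ s q, A s q = (q.1, s * q.2) := fun s q => by simp [A]
  have hF : AnalyticAt ℝ (fun q => fderiv ℝ f q (0, 1)) 0 :=
    hf.fderiv_apply_const (0, 1)
  refine ⟨_, hF.intervalIntegral_comp_clm hA continuous_const (k := fun _ => 1) zero_le_one, ?_⟩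
  obtain ⟨ε, hε, hball⟩ := Metric.eventually_nhds_iff_ball.1 hf.eventually_analyticAt
  filter_upwards [Metric.ball_mem_nhds (0 : ℝ × ℝ) hε] with q hq
  have hmem : ∀ s ∈ Icc (0 : ℝ) 1, A s q ∈ Metric.ball (0 : ℝ × ℝ) ε := by
    intro s hs
    rw [mem_ball_zero_iff, Prod.norm_def, max_lt_iff] at hq
    rw [hAa, mem_ball_zero_iff, Prod.norm_def, max_lt_iff]
    refine ⟨hq.1, lt_of_le_of_lt ?_ hq.2⟩
    rw [norm_mul, Real.norm_of_nonneg hs.1]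
    exact mul_le_of_le_one_left (norm_nonneg _) hs.2
  have hder : ∀ s ∈ uIcc (0 : ℝ) 1, HasDerivAt (fun s => f (q.1, s * q.2))
      (q.2 * fderiv ℝ f (A s q) (0, 1)) s := by
    intro s hs
    rw [uIcc_of_le zero_le_one] at hs
    have h1 := (hball _ (hmem s hs)).differentiableAt.hasFDerivAt
    rw [hAa] at h1 ⊢
    have h2 : HasDerivAt (fun s : ℝ => (q.1, s * q.2)) (0, q.2) s := by
      simpa using (hasDerivAt_const s q.1).prodMk ((hasDerivAt_id s).mul_const q.2)
    have h3 := h1.comp_hasDerivAt s h2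
    convert! h3 using 1
    rw [← smul_eq_mul, ← map_smul]
    simp
  have hint := intervalIntegral.integral_eq_sub_of_hasDerivAt hder (by
    refine ContinuousOn.intervalIntegrable fun s hs => ContinuousAt.continuousWithinAt ?_
    rw [uIcc_of_le zero_le_one] at hs
    have h1 : AnalyticAt ℝ (fun q => fderiv ℝ f q (0, 1)) (A s q) :=
      (hball _ (hmem s hs)).fderiv_apply_const (0, 1)
    refine continuousAt_const.mul ?_
    exact ContinuousAt.comp (f := fun s => A s q) h1.continuousAt (by fun_prop))
  rw [intervalIntegral.integral_const_mul] at hint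
  simp only [one_mul, zero_mul, Prod.mk.eta] at hint ⊢
  linarith

/-- The set `v ≠ 0` is dense, so a factor `v` may be cancelled. -/
theorem eventually_eq_zero_of_snd_mul {f : ℝ × ℝ → ℝ} (hf : AnalyticAt ℝ f 0)
    (h : ∀ᶠ q in 𝓝 (0 : ℝ × ℝ), q.2 * f q = 0) : ∀ᶠ q in 𝓝 (0 : ℝ × ℝ), f q = 0 := by
  filter_upwards [hf.eventually_continuousAt, h.eventually_nhds] with q hq hz
  by_cases h2 : q.2 = 0
  swap
  · exact (mul_eq_zero.1 hz.self_of_nhds).resolve_left h2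
  have hc : Tendsto (fun v : ℝ => (q.1, v)) (𝓝[≠] 0) (𝓝 q) := by
    have : Tendsto (fun v : ℝ => (q.1, v)) (𝓝 0) (𝓝 (q.1, 0)) := by
      apply Continuous.tendsto; fun_prop
    rw [show q = (q.1, 0) from Prod.ext rfl h2]
    exact this.mono_left nhdsWithin_le_nhds
  refine tendsto_nhds_unique (hq.tendsto.comp hc) ?_
  refine tendsto_const_nhds.congr' ?_
  filter_upwards [hc.eventually hz, self_mem_nhdsWithin] with v hv hv0
  exact ((mul_eq_zero.1 hv).resolve_left hv0).symm

/-! ### Double power series and even functions -/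

theorem summable_norm_mul_pow_mul_pow {a : ℕ → ℕ → ℝ} {K r : ℝ} (hr : 0 < r)
    (ha : ∀ j k, |a j k| * r ^ (j + k) ≤ K) {u v : ℝ} (hu : |u| < r) (hv : |v| < r) :
    Summable fun jk : ℕ × ℕ => ‖a jk.1 jk.2 * u ^ jk.1 * v ^ jk.2‖ := by
  have hs : Summable fun jk : ℕ × ℕ => K * ((|u| / r) ^ jk.1 * (|v| / r) ^ jk.2) := by
    refine Summable.mul_left _ (Summable.mul_of_nonneg (summable_geometric_of_lt_one ?_ ?_)
      (summable_geometric_of_lt_one ?_ ?_) ?_ ?_)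
    · positivity
    · exact (div_lt_one hr).2 hu
    · positivity
    · exact (div_lt_one hr).2 hv
    · intro j; positivity
    · intro j; positivity
  refine Summable.of_nonneg_of_le (fun _ => norm_nonneg _) (fun jk => ?_) hs
  obtain ⟨j, k⟩ := jk
  calc ‖a j k * u ^ j * v ^ k‖ = (|a j k| * r ^ (j + k)) * ((|u| / r) ^ j * (|v| / r) ^ k) := by
        rw [norm_mul, norm_mul, norm_pow, norm_pow, Real.norm_eq_abs, Real.norm_eq_abs,
          Real.norm_eq_abs]
        rw [div_pow, div_pow, pow_add]
        field_simp
    _ ≤ _ := by gcongr; exact ha j k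

/-- The symbol of the monomial `u ^ j * v ^ (n - j)`: a continuous `n`-linear form. -/
noncomputable def monomialForm (n j : ℕ) :
    ContinuousMultilinearMap ℝ (fun _ : Fin n => ℝ × ℝ) ℝ :=
  (ContinuousMultilinearMap.mkPiAlgebraFin ℝ n ℝ).compContinuousLinearMap fun i =>
    if (i : ℕ) < j then ContinuousLinearMap.fst ℝ ℝ ℝ else ContinuousLinearMap.snd ℝ ℝ ℝ

theorem norm_monomialForm_le (n j : ℕ) : ‖monomialForm n j‖ ≤ 1 := by
  refine (ContinuousMultilinearMap.norm_compContinuousLinearMap_le _ _).trans ?_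
  rw [ContinuousMultilinearMap.norm_mkPiAlgebraFin, one_mul]
  refine Finset.prod_le_one (fun _ _ => norm_nonneg _) fun i _ => ?_
  split_ifs
  · exact ContinuousLinearMap.norm_fst_le ..
  · exact ContinuousLinearMap.norm_snd_le ..

theorem monomialForm_apply_const (j k : ℕ) (q : ℝ × ℝ) :
    monomialForm (j + k) j (fun _ => q) = q.1 ^ j * q.2 ^ k := by
  simp only [monomialForm, ContinuousMultilinearMap.compContinuousLinearMap_apply,
    ContinuousMultilinearMap.mkPiAlgebraFin_apply, List.prod_ofFn]
  rw [Fin.prod_univ_add]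
  simp

/-- A double power series whose coefficients grow at most geometrically defines a function that is
analytic at the origin. -/
theorem analyticAt_of_hasSum_mul_pow {a : ℕ → ℕ → ℝ} {K r : ℝ} (hr : 0 < r)
    (ha : ∀ j k, |a j k| * r ^ (j + k) ≤ K) {f : ℝ × ℝ → ℝ}
    (hf : ∀ u v, |u| < r → |v| < r →
      HasSum (fun jk : ℕ × ℕ => a jk.1 jk.2 * u ^ jk.1 * v ^ jk.2) (f (u, v))) :
    AnalyticAt ℝ f 0 := by
  let p : FormalMultilinearSeries ℝ (ℝ × ℝ) ℝ := fun n =>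
    ∑ jk ∈ Finset.HasAntidiagonal.antidiagonal n, a jk.1 jk.2 • monomialForm n jk.1
  have hpa : ∀ n q, p n (fun _ => q) =
      ∑ jk ∈ Finset.HasAntidiagonal.antidiagonal n, a jk.1 jk.2 * q.1 ^ jk.1 * q.2 ^ jk.2 := by
    intro n q
    simp only [p, sum_apply, smul_apply]
    refine Finset.sum_congr rfl fun jk hjk => ?_
    obtain ⟨j, k⟩ := jk
    obtain rfl := Finset.HasAntidiagonal.mem_antidiagonal.1 hjk
    simp only [monomialForm_apply_const, smul_eq_mul, mul_assoc]
  have hK : 0 ≤ K := by simpa using (mul_nonneg (abs_nonneg _) (by positivity)).trans (ha 0 0)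
  have hpn : ∀ n, ‖p n‖ * (r / 2) ^ n ≤ K := by
    intro n
    have h1 : ‖p n‖ ≤ ∑ jk ∈ Finset.HasAntidiagonal.antidiagonal n, |a jk.1 jk.2| := by
      refine (norm_sum_le _ _).trans (Finset.sum_le_sum fun jk _ => ?_)
      rw [norm_smul]
      exact mul_le_of_le_one_right (norm_nonneg _) (norm_monomialForm_le _ _)
    have h2 : (∑ jk ∈ Finset.HasAntidiagonal.antidiagonal n, |a jk.1 jk.2|) * r ^ n ≤
        (n + 1) * K := by
      rw [Finset.sum_mul]
      refine (Finset.sum_le_card_nsmul _ _ K fun jk hjk => ?_).trans ?_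
      · rw [← Finset.HasAntidiagonal.mem_antidiagonal.1 hjk]; exact ha _ _
      · simp
    have h3 : (n + 1 : ℝ) ≤ 2 ^ n := by exact_mod_cast Nat.lt_two_pow_self (n := n)
    calc ‖p n‖ * (r / 2) ^ n
        ≤ (∑ jk ∈ Finset.HasAntidiagonal.antidiagonal n, |a jk.1 jk.2|) * (r / 2) ^ n := by
          gcongr
      _ = ((∑ jk ∈ Finset.HasAntidiagonal.antidiagonal n, |a jk.1 jk.2|) * r ^ n) / 2 ^ n := by
          rw [div_pow]; ring
      _ ≤ (2 ^ n * K) / 2 ^ n := by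
          exact div_le_div_of_nonneg_right (h2.trans (mul_le_mul_of_nonneg_right h3 hK))
            (by positivity)
      _ = K := by field_simp
  have hr2 : 0 < r / 2 := half_pos hr
  have hrad : ENNReal.ofReal (r / 2) ≤ p.radius := by
    refine p.le_radius_of_bound (r := (r / 2).toNNReal) K fun n => ?_
    rw [Real.coe_toNNReal _ hr2.le]; exact hpn n
  have h0 : 0 < ENNReal.ofReal (r / 2) := by simpa using hr
  refine ⟨p, ENNReal.ofReal (r / 2), ⟨hrad, h0, ?_⟩⟩
  intro q hq
  rw [Metric.eball_ofReal, mem_ball_zero_iff, Prod.norm_def, max_lt_iff] at hq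
  have hu : |q.1| < r := hq.1.trans (by linarith)
  have hv : |q.2| < r := hq.2.trans (by linarith)
  have h := hf q.1 q.2 hu hv
  rw [← (Finset.HasAntidiagonal.sigmaAntidiagonalEquivProd (A := ℕ)).hasSum_iff] at h
  have h' := h.sigma (g := fun n => p n fun _ => q) (fun n => by
    rw [hpa]
    have := hasSum_fintype (fun jk : Finset.HasAntidiagonal.antidiagonal n =>
      a jk.1.1 jk.1.2 * q.1 ^ jk.1.1 * q.2 ^ jk.1.2)
    rw [Finset.sum_coe_sort (Finset.HasAntidiagonal.antidiagonal n)
      (fun jk => a jk.1 jk.2 * q.1 ^ jk.1 * q.2 ^ jk.2)] at this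
    exact this)
  simpa using h'

/-- An analytic germ of two variables is the sum of its double Taylor series. -/
theorem AnalyticAt.exists_hasSum_mul_pow {f : ℝ × ℝ → ℝ} (hf : AnalyticAt ℝ f 0) :
    ∃ (a : ℕ → ℕ → ℝ) (K r : ℝ), 0 < r ∧ (∀ j k, |a j k| * r ^ (j + k) ≤ K) ∧
      ∀ u v, |u| < r → |v| < r →
        HasSum (fun jk : ℕ × ℕ => a jk.1 jk.2 * u ^ jk.1 * v ^ jk.2) (f (u, v)) := by
  classical
  obtain ⟨p, R, hp⟩ := hf
  obtain ⟨ρ, hρ0, hρ⟩ := ENNReal.lt_iff_exists_nnreal_btwn.1 hp.r_pos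
  have hρ0' : (0 : ℝ) < ρ := by exact_mod_cast hρ0
  obtain ⟨K, hK0, hK⟩ := p.norm_mul_pow_le_of_lt_radius (hρ.trans_le hp.r_le)
  let a : ℕ → ℕ → ℝ := fun j k => ∑ s ∈ (Finset.univ : Finset (Fin (j + k))).powersetCard j,
    p (j + k) (s.piecewise (fun _ => (1, 0)) (fun _ => (0, 1)))
  have han : ∀ n j k, j + k = n → a j k =
      ∑ s ∈ (Finset.univ : Finset (Fin n)).powersetCard j,
        p n (s.piecewise (fun _ => (1, 0)) (fun _ => (0, 1))) := by
    rintro n j k rfl; rfl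
  have hab : ∀ j k, |a j k| * (ρ / 2 : ℝ) ^ (j + k) ≤ K := by
    intro j k
    have h1 : |a j k| ≤ 2 ^ (j + k) * ‖p (j + k)‖ := by
      refine (Finset.abs_sum_le_sum_abs _ _).trans ?_
      refine (Finset.sum_le_card_nsmul _ _ ‖p (j + k)‖ fun s _ => ?_).trans ?_
      · refine ((p (j + k)).le_opNorm _).trans (mul_le_of_le_one_right (norm_nonneg _) ?_)
        refine Finset.prod_le_one (fun _ _ => norm_nonneg _) fun i _ => ?_
        by_cases hi : i ∈ s <;> simp [hi, Prod.norm_def]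
      · rw [nsmul_eq_mul]
        gcongr
        rw [Finset.card_powersetCard, Finset.card_univ, Fintype.card_fin]
        exact_mod_cast Nat.choose_le_two_pow _ _
    calc _ ≤ (2 ^ (j + k) * ‖p (j + k)‖) * (ρ / 2 : ℝ) ^ (j + k) := by gcongr
      _ = ‖p (j + k)‖ * (ρ : ℝ) ^ (j + k) := by rw [div_pow]; field_simp
      _ ≤ K := hK _
  refine ⟨a, K, ρ / 2, by positivity, hab, fun u v hu hv => ?_⟩
  have hsum := (summable_norm_mul_pow_mul_pow (by positivity) hab hu hv).of_norm
  have h := hsum.hasSum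
  have hq : ((u, v) : ℝ × ℝ) ∈ Metric.eball (0 : ℝ × ℝ) R := by
    refine Metric.eball_subset_eball hρ.le ?_
    rw [Metric.eball_coe, mem_ball_zero_iff, Prod.norm_def, max_lt_iff]
    exact ⟨hu.trans (by linarith), hv.trans (by linarith)⟩
  have hf := hp.hasSum hq
  rw [zero_add] at hf
  have h2 := h
  rw [← (Finset.HasAntidiagonal.sigmaAntidiagonalEquivProd (A := ℕ)).hasSum_iff] at h2
  have h' := h2.sigma (g := fun n => p n fun _ => (u, v)) (fun n => by
    have key : p n (fun _ => (u, v)) =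
        ∑ jk ∈ Finset.HasAntidiagonal.antidiagonal n, a jk.1 jk.2 * u ^ jk.1 * v ^ jk.2 := by
      have e : (fun _ : Fin n => ((u, v) : ℝ × ℝ)) = (fun _ => (u, 0)) + fun _ => (0, v) := by
        ext <;> simp
      rw [e, (p n).map_add_univ, ← Finset.powerset_univ, Finset.sum_powerset]
      rw [Finset.card_univ, Fintype.card_fin, Finset.Nat.sum_antidiagonal_eq_sum_range_succ_mk]
      refine Finset.sum_congr rfl fun j hj => ?_
      have hj' : j + (n - j) = n := by
        have := Finset.mem_range.1 hj; omega
      simp only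
      rw [han n j (n - j) hj', Finset.sum_mul, Finset.sum_mul]
      refine Finset.sum_congr rfl fun s hs => ?_
      have hsc := (Finset.mem_powersetCard.1 hs).2
      have e2 : s.piecewise (fun _ : Fin n => ((u, 0) : ℝ × ℝ)) (fun _ => (0, v)) =
          fun i => (s.piecewise (fun _ => u) (fun _ => v) i) •
            (s.piecewise (fun _ => ((1, 0) : ℝ × ℝ)) (fun _ => (0, 1)) i) := by
        ext i <;> by_cases hi : i ∈ s <;> simp [hi]
      rw [e2, (p n).map_smul_univ, Finset.prod_piecewise]
      simp [Finset.univ_inter, Finset.prod_const, hsc, Finset.card_sdiff, smul_eq_mul]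
      ring
    rw [key]
    have := hasSum_fintype (fun jk : Finset.HasAntidiagonal.antidiagonal n =>
      a jk.1.1 jk.1.2 * u ^ jk.1.1 * v ^ jk.1.2)
    rw [Finset.sum_coe_sort (Finset.HasAntidiagonal.antidiagonal n)
      (fun jk => a jk.1 jk.2 * u ^ jk.1 * v ^ jk.2)] at this
    exact this)
  rw [hf.unique h']
  exact h

/-- An analytic germ that is even in `v` is an analytic function of `(u, v ^ 2)`. -/
theorem AnalyticAt.exists_eq_comp_sq {f : ℝ × ℝ → ℝ} (hf : AnalyticAt ℝ f 0)
    (heven : ∀ᶠ q in 𝓝 (0 : ℝ × ℝ), f (q.1, -q.2) = f q) :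
    ∃ g : ℝ × ℝ → ℝ, AnalyticAt ℝ g 0 ∧ ∀ᶠ q in 𝓝 (0 : ℝ × ℝ), f q = g (q.1, q.2 ^ 2) := by
  obtain ⟨a, K, r₀, hr₀, ha₀, hsum⟩ := hf.exists_hasSum_mul_pow
  -- With `r ≤ 1` the bounds for the even coefficients hold at radius `r ^ 2`.
  set r := min r₀ 1 with hrdef
  have hr : 0 < r := lt_min hr₀ one_pos
  have hr1 : r ≤ 1 := min_le_right _ _
  have ha : ∀ j k, |a j k| * r ^ (j + k) ≤ K := fun j k =>
    le_trans (by gcongr; exact min_le_left _ _) (ha₀ j k)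
  have hb : ∀ j k, |a j (2 * k)| * (r ^ 2) ^ (j + k) ≤ K := by
    intro j k
    refine le_trans ?_ (ha j (2 * k))
    rw [← pow_mul]
    gcongr ?_ * ?_
    exact pow_le_pow_of_le_one hr.le hr1 (by omega)
  have hr2 : 0 < r ^ 2 := by positivity
  let g : ℝ × ℝ → ℝ := fun q => ∑' jk : ℕ × ℕ, a jk.1 (2 * jk.2) * q.1 ^ jk.1 * q.2 ^ jk.2
  have hg : ∀ u w, |u| < r ^ 2 → |w| < r ^ 2 →
      HasSum (fun jk : ℕ × ℕ => a jk.1 (2 * jk.2) * u ^ jk.1 * w ^ jk.2) (g (u, w)) :=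
    fun u w hu hw => (summable_norm_mul_pow_mul_pow hr2 hb hu hw).of_norm.hasSum
  refine ⟨g, analyticAt_of_hasSum_mul_pow hr2 hb hg, ?_⟩
  filter_upwards [heven, Metric.ball_mem_nhds (0 : ℝ × ℝ) hr2] with q hq hqb
  rw [mem_ball_zero_iff, Prod.norm_def, max_lt_iff] at hqb
  obtain ⟨u, v⟩ := q
  simp only [Real.norm_eq_abs] at hqb
  have hrr : r ^ 2 ≤ r := by nlinarith
  have hrr0 : r ≤ r₀ := min_le_left _ _
  have h1 := hsum u v (by linarith) (by linarith)
  have h2 := hsum u (-v) (by linarith) (by rw [abs_neg]; linarith)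
  simp only at hq
  rw [hq] at h2
  have h3 := (h1.add h2).mul_left (1 / 2)
  have h4 := hg u (v ^ 2) hqb.1 (by
    rw [abs_pow]
    exact pow_lt_pow_left₀ (by linarith) (abs_nonneg v) two_ne_zero)
  have hinj : Function.Injective (fun jk : ℕ × ℕ => (jk.1, 2 * jk.2)) := by
    rintro ⟨j, k⟩ ⟨j', k'⟩ h
    simp only [Prod.mk.injEq] at h ⊢
    omega
  rw [← hinj.hasSum_iff] at h3
  · have h5 : (fun jk : ℕ × ℕ => a jk.1 (2 * jk.2) * u ^ jk.1 * (v ^ 2) ^ jk.2) =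
        (fun jk : ℕ × ℕ => 1 / 2 * (a jk.1 jk.2 * u ^ jk.1 * v ^ jk.2 +
          a jk.1 jk.2 * u ^ jk.1 * (-v) ^ jk.2)) ∘ fun jk => (jk.1, 2 * jk.2) := by
      ext jk
      simp only [Function.comp_apply, pow_mul, neg_sq]
      ring
    rw [← h5] at h3
    have := h3.unique h4
    simp only
    linarith
  · rintro ⟨j, k⟩ hjk
    have hk : Odd k := by
      by_contra hk
      obtain ⟨l, rfl⟩ := Nat.not_odd_iff_even.1 hk
      exact hjk ⟨(j, l), by simp [two_mul]⟩
    simp [hk.neg_pow]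

/-! ### Local analytic diffeomorphisms -/

theorem AnalyticAt.exists_openPartialHomeomorph {E : Type*} [NormedAddCommGroup E]
    [NormedSpace ℝ E] [CompleteSpace E] {f : E → E} (hf : AnalyticAt ℝ f 0)
    (hinv : (fderiv ℝ f 0).IsInvertible) {S : Set E} (hS : S ∈ 𝓝 0) :
    ∃ h : OpenPartialHomeomorph E E, 0 ∈ h.source ∧ h.source ⊆ S ∧ ⇑h = f ∧
      AnalyticOnNhd ℝ f h.source ∧ AnalyticOnNhd ℝ h.symm h.target := by
  obtain ⟨e, he⟩ := hinv
  have hst : HasStrictFDerivAt f (e : E →L[ℝ] E) 0 := by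
    rw [he]; exact hf.hasStrictFDerivAt
  have hnh : {q | AnalyticAt ℝ f q} ∩ {q | (fderiv ℝ f q).IsInvertible} ∩ S ∈ 𝓝 (0 : E) := by
    refine inter_mem (inter_mem hf.eventually_analyticAt ?_) hS
    have h1 : ContinuousAt (fderiv ℝ f) 0 := hf.fderiv.continuousAt
    refine h1.eventually (p := fun A => A.IsInvertible) ?_
    rw [← he]
    filter_upwards [ContinuousLinearEquiv.nhds e] with A hA
    exact hA
  let h := (hst.toOpenPartialHomeomorph f).restr
    ({q | AnalyticAt ℝ f q} ∩ {q | (fderiv ℝ f q).IsInvertible} ∩ S)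
  have hsub : h.source ⊆ {q | AnalyticAt ℝ f q} ∩ {q | (fderiv ℝ f q).IsInvertible} ∩ S := by
    rw [OpenPartialHomeomorph.restr_source]
    exact inter_subset_right.trans interior_subset
  refine ⟨h, ?_, fun q hq => (hsub hq).2, rfl, fun q hq => (hsub hq).1.1, fun y hy => ?_⟩
  · rw [OpenPartialHomeomorph.restr_source]
    exact ⟨hst.mem_toOpenPartialHomeomorph_source, mem_interior_iff_mem_nhds.2 hnh⟩
  · have hq := hsub (h.map_target hy)
    obtain ⟨i, hi⟩ := hq.1.2
    exact h.analyticAt_symm hy hq.1.1 hi.symm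

/-- Two vector fields that are mapped to the same vector field `Z` by local analytic
diffeomorphisms are analytically conjugate. -/
theorem analyticallyConjugateNearZero_of_common {X Y Z : ℝ × ℝ → ℝ × ℝ} {Ω Ω' : Set (ℝ × ℝ)}
    (hΩ : Ω ∈ 𝓝 0) (hΩ' : Ω' ∈ 𝓝 0) {f g : ℝ × ℝ → ℝ × ℝ} (hf : AnalyticAt ℝ f 0)
    (hg : AnalyticAt ℝ g 0) (hf0 : f 0 = 0) (hg0 : g 0 = 0)
    (hfi : (fderiv ℝ f 0).IsInvertible) (hgi : (fderiv ℝ g 0).IsInvertible)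
    (hfX : ∀ᶠ q in 𝓝 0, fderiv ℝ f q (X q) = Z (f q))
    (hgY : ∀ᶠ q in 𝓝 0, fderiv ℝ g q (Y q) = Z (g q)) :
    AnalyticallyConjugateNearZero X Ω Y Ω' := by
  obtain ⟨h₁, h₁0, h₁S, h₁f, h₁a, h₁s⟩ := hf.exists_openPartialHomeomorph hfi (inter_mem hΩ hfX)
  obtain ⟨h₂, h₂0, h₂S, h₂g, h₂a, h₂s⟩ := hg.exists_openPartialHomeomorph hgi (inter_mem hΩ' hgY)
  have hh : ∀ q, (h₁.trans h₂.symm) q = h₂.symm (f q) := fun q => by simp [h₁f]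
  have h₂g0 : h₂.symm 0 = 0 := by
    have := h₂.left_inv h₂0
    rwa [h₂g, hg0] at this
  refine ⟨h₁.trans h₂.symm, ?_, ?_, ?_, ?_, ?_, ?_, ?_⟩
  · rw [OpenPartialHomeomorph.trans_source]
    refine ⟨h₁0, ?_⟩
    have := h₂.map_source h₂0
    rw [h₂g, hg0] at this
    change h₁ 0 ∈ h₂.target
    rw [h₁f, hf0]
    exact this
  · rw [hh]
    change h₂.symm (f 0) = 0
    rw [hf0, h₂g0]
  · rw [OpenPartialHomeomorph.trans_source]
    exact fun q hq => (h₁S hq.1).1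
  · rw [OpenPartialHomeomorph.trans_target]
    exact fun q hq => (h₂S hq.1).1
  · intro q hq
    rw [OpenPartialHomeomorph.trans_source] at hq
    have hq2 : f q ∈ h₂.target := by
      have := hq.2
      rwa [mem_preimage, h₁f] at this
    exact ((h₂s _ hq2).comp (h₁a q hq.1)).congr (Eventually.of_forall fun q => (hh q).symm)
  · intro y hy
    rw [OpenPartialHomeomorph.trans_target] at hy
    have hy2 : g y ∈ h₁.target := by
      have := hy.2
      rwa [mem_preimage, OpenPartialHomeomorph.symm_symm, h₂g] at this
    have := (h₁s _ hy2).comp (h₂a y hy.1)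
    refine this.congr (Eventually.of_forall fun q => ?_)
    simp [h₂g]
  · intro q hq
    rw [OpenPartialHomeomorph.trans_source] at hq
    have hq2 : f q ∈ h₂.target := by
      have := hq.2
      rwa [mem_preimage, h₁f] at this
    set z := h₂.symm (f q) with hz
    have hzs : z ∈ h₂.source := h₂.map_target hq2
    have hgz : g z = f q := by rw [← h₂g]; exact h₂.right_inv hq2
    have e1 : ⇑(h₁.trans h₂.symm) = h₂.symm ∘ f := funext hh
    have hd2 : DifferentiableAt ℝ h₂.symm (f q) := (h₂s _ hq2).differentiableAt
    rw [e1, fderiv_comp q hd2 (h₁a q hq.1).differentiableAt]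
    rw [ContinuousLinearMap.comp_apply, (h₁S hq.1).2, ← hgz, ← (h₂S hzs).2]
    rw [← hgz] at hd2
    rw [← ContinuousLinearMap.comp_apply, ← fderiv_comp z hd2 (h₂a z hzs).differentiableAt]
    have e2 : h₂.symm ∘ g =ᶠ[𝓝 z] id := by
      filter_upwards [h₂.open_source.mem_nhds hzs] with y hy
      rw [← h₂g]; exact h₂.left_inv hy
    rw [e2.fderiv_eq, fderiv_id]
    change Y z = Y ((h₂.symm ∘ f) q)
    rfl

/-! ### Analytic flows and first integrals -/

/-- The primitive vanishing at `0` of a continuous function on `[0, 1]`. -/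
noncomputable def primitiveCLM : C(Icc (0 : ℝ) 1, ℝ) →L[ℝ] C(Icc (0 : ℝ) 1, ℝ) :=
  LinearMap.mkContinuous
    { toFun := fun y => ⟨fun t => ∫ s in (0 : ℝ)..t, y (projIcc 0 1 zero_le_one s), by
        have h : Continuous fun s => y (projIcc (0 : ℝ) 1 zero_le_one s) :=
          y.continuous.comp continuous_projIcc
        exact (intervalIntegral.continuous_primitive (fun a b => h.intervalIntegrable a b) 0).comp
          continuous_subtype_val⟩
      map_add' := fun x y => by
        ext t
        simp only [ContinuousMap.coe_mk, ContinuousMap.add_apply]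
        exact intervalIntegral.integral_add
          ((x.continuous.comp continuous_projIcc).intervalIntegrable _ _)
          ((y.continuous.comp continuous_projIcc).intervalIntegrable _ _)
      map_smul' := fun c x => by
        ext t
        simp only [ContinuousMap.coe_mk, ContinuousMap.smul_apply, RingHom.id_apply]
        exact intervalIntegral.integral_smul _ _ } 1 (by
    intro y
    refine (ContinuousMap.norm_le _ (by positivity)).2 fun t => ?_
    have := intervalIntegral.norm_integral_le_of_norm_le_const (a := 0) (b := (t : ℝ))
      (f := fun s => y (projIcc (0 : ℝ) 1 zero_le_one s)) (C := ‖y‖)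
      (fun s _ => y.norm_coe_le_norm _)
    refine this.trans ?_
    rw [sub_zero, abs_of_nonneg t.2.1, mul_comm]
    exact mul_le_mul_of_nonneg_right t.2.2 (norm_nonneg _))

theorem primitiveCLM_apply (y : C(Icc (0 : ℝ) 1, ℝ)) (t : Icc (0 : ℝ) 1) :
    primitiveCLM y t = ∫ s in (0 : ℝ)..t, y (projIcc 0 1 zero_le_one s) := rfl

/-- The solution of `∂φ/∂u = F(u, φ)`, `φ(0, w) = w`, depends analytically on `(u, w)`, stated in
integrated form. The time interval is rescaled to `[0, 1]`, where the integral equation is solved by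
the analytic implicit function theorem in the space of continuous functions. -/
theorem AnalyticAt.exists_integral_flow {F : ℝ × ℝ → ℝ} (hF : AnalyticAt ℝ F 0) :
    ∃ φ : ℝ × ℝ → ℝ, AnalyticAt ℝ φ 0 ∧
      ∀ᶠ q in 𝓝 (0 : ℝ × ℝ), φ q = q.2 + ∫ s in (0 : ℝ)..q.1, F (s, φ (s, q.2)) := by
  obtain ⟨N, hN, hNF⟩ := hF.exists_superposition (Icc (0 : ℝ) 1)
  -- `graph (ε, y)` is the path `t ↦ (ε t, y t)`.
  let graph : ℝ × C(Icc (0 : ℝ) 1, ℝ) →L[ℝ] C(Icc (0 : ℝ) 1, ℝ × ℝ) :=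
    LinearMap.mkContinuous
      { toFun := fun p => ⟨fun t => (p.1 * t, p.2 t), by fun_prop⟩
        map_add' := fun x y => by ext <;> simp [add_mul]
        map_smul' := fun c x => by ext <;> simp [mul_assoc] } 1 (by
      intro p
      refine (ContinuousMap.norm_le _ (by positivity)).2 fun t => ?_
      rw [one_mul, Prod.norm_def, Prod.norm_def]
      refine max_le_max ?_ (p.2.norm_coe_le_norm t)
      change ‖p.1 * t‖ ≤ ‖p.1‖
      rw [norm_mul]
      refine mul_le_of_le_one_right (norm_nonneg _) ?_
      rw [Real.norm_of_nonneg t.2.1]; exact t.2.2)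
  let const : ℝ →L[ℝ] C(Icc (0 : ℝ) 1, ℝ) :=
    LinearMap.mkContinuous
      { toFun := fun w => ContinuousMap.const _ w
        map_add' := fun x y => rfl
        map_smul' := fun c x => rfl } 1 (by
      intro w
      exact (ContinuousMap.norm_le _ (by positivity)).2 fun t => (one_mul ‖w‖).ge)
  have hconst : ∀ w t, const w t = w := fun _ _ => rfl
  let Φ : (ℝ × ℝ) × C(Icc (0 : ℝ) 1, ℝ) → C(Icc (0 : ℝ) 1, ℝ) := fun x =>
    x.2 - const x.1.2 - x.1.1 • primitiveCLM (N (graph (x.1.1, x.2)))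
  have e11 : AnalyticAt ℝ (fun x : (ℝ × ℝ) × C(Icc (0 : ℝ) 1, ℝ) => x.1.1) 0 :=
    AnalyticAt.fun_comp (g := Prod.fst) analyticAt_fst analyticAt_fst
  have e12 : AnalyticAt ℝ (fun x : (ℝ × ℝ) × C(Icc (0 : ℝ) 1, ℝ) => x.1.2) 0 :=
    AnalyticAt.fun_comp (g := Prod.snd) analyticAt_snd analyticAt_fst
  have hNg : AnalyticAt ℝ (fun x : (ℝ × ℝ) × C(Icc (0 : ℝ) 1, ℝ) => N (graph (x.1.1, x.2))) 0 := by
    have h1 : AnalyticAt ℝ (fun x : (ℝ × ℝ) × C(Icc (0 : ℝ) 1, ℝ) => graph (x.1.1, x.2)) 0 :=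
      (graph.analyticAt _).fun_comp (e11.prod analyticAt_snd)
    refine AnalyticAt.fun_comp (g := N) ?_ h1
    have : graph ((0 : (ℝ × ℝ) × C(Icc (0 : ℝ) 1, ℝ)).1.1,
      (0 : (ℝ × ℝ) × C(Icc (0 : ℝ) 1, ℝ)).2) = 0 := map_zero graph
    rw [this]; exact hN
  have hΦ : AnalyticAt ℝ Φ 0 := by
    have h2 : AnalyticAt ℝ (fun x : (ℝ × ℝ) × C(Icc (0 : ℝ) 1, ℝ) =>
        primitiveCLM (N (graph (x.1.1, x.2)))) 0 := (primitiveCLM.analyticAt _).fun_comp hNg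
    have h3 : AnalyticAt ℝ (fun x : (ℝ × ℝ) × C(Icc (0 : ℝ) 1, ℝ) => const x.1.2) 0 :=
      (const.analyticAt _).fun_comp e12
    exact (analyticAt_snd.sub h3).sub (e11.smul h2)
  have hc : ContDiffAt ℝ ⊤ Φ 0 := hΦ.contDiffAt
  have hinr : fderiv ℝ Φ 0 ∘L .inr ℝ (ℝ × ℝ) C(Icc (0 : ℝ) 1, ℝ) = .id ℝ _ := by
    have h1 : HasFDerivAt (Φ ∘ fun y => ((0 : ℝ × ℝ), y)) (fderiv ℝ Φ 0 ∘L
        .inr ℝ (ℝ × ℝ) C(Icc (0 : ℝ) 1, ℝ)) 0 :=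
      HasFDerivAt.comp (0 : C(Icc (0 : ℝ) 1, ℝ)) hΦ.differentiableAt.hasFDerivAt
        (hasFDerivAt_prodMk_right (0 : ℝ × ℝ) (0 : C(Icc (0 : ℝ) 1, ℝ)))
    have h2 : (Φ ∘ fun y => ((0 : ℝ × ℝ), y)) = id := by
      ext y t
      simp [Φ]
    rw [h2] at h1
    exact h1.unique (hasFDerivAt_id _)
  have hinv : (fderiv ℝ Φ 0 ∘L .inr ℝ (ℝ × ℝ) C(Icc (0 : ℝ) 1, ℝ)).IsInvertible := by
    rw [hinr]; exact ⟨ContinuousLinearEquiv.refl ℝ _, rfl⟩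
  let Y := hc.implicitFunction (by simp) hinv
  have hYa : AnalyticAt ℝ Y 0 := (hc.contDiffAt_implicitFunction (by simp) hinv).analyticAt
  have hY0 : Y 0 = 0 := hc.implicitFunction_apply_self (by simp) hinv
  have hΦ0 : Φ 0 = 0 := by simp [Φ]
  have hYΦ : ∀ᶠ p in 𝓝 (0 : ℝ × ℝ), Φ (p, Y p) = 0 := by
    have := hc.eventually_apply_implicitFunction (by simp) hinv
    rw [hΦ0] at this; exact this
  have hYu : ∀ᶠ x in 𝓝 (0 : (ℝ × ℝ) × C(Icc (0 : ℝ) 1, ℝ)), Φ x = 0 → Y x.1 = x.2 := by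
    filter_upwards [hc.eventually_apply_eq_iff_implicitFunction (by simp) hinv] with x hx h
    rw [hΦ0] at hx; exact hx.1 h
  have hNF' : ∀ᶠ x in 𝓝 (0 : (ℝ × ℝ) × C(Icc (0 : ℝ) 1, ℝ)),
      ∀ t, N (graph (x.1.1, x.2)) t = F (x.1.1 * t, x.2 t) := by
    have h1 : Tendsto (fun x : (ℝ × ℝ) × C(Icc (0 : ℝ) 1, ℝ) => graph (x.1.1, x.2)) (𝓝 0)
        (𝓝 0) := by
      have : Continuous (fun x : (ℝ × ℝ) × C(Icc (0 : ℝ) 1, ℝ) => graph (x.1.1, x.2)) := by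
        fun_prop
      convert! this.tendsto 0
      exact (map_zero graph).symm
    exact h1.eventually hNF
  obtain ⟨δ, hδ, hball⟩ := Metric.eventually_nhds_iff_ball.1 (hYu.and hNF')
  have hYt : Tendsto Y (𝓝 0) (𝓝 0) := by
    have := hYa.continuousAt.tendsto; rwa [hY0] at this
  let φ : ℝ × ℝ → ℝ := fun p => Y p 1
  have hφ : AnalyticAt ℝ φ 0 :=
    ((ContinuousMap.evalCLM ℝ (1 : Icc (0 : ℝ) 1) : C(Icc (0 : ℝ) 1, ℝ) →L[ℝ] ℝ).analyticAt
      _).fun_comp hYa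
  refine ⟨φ, hφ, ?_⟩
  filter_upwards [hYΦ, Metric.ball_mem_nhds (0 : ℝ × ℝ) hδ,
    hYt.eventually (Metric.ball_mem_nhds 0 hδ)] with p hp hpδ hYδ
  obtain ⟨ε, w⟩ := p
  rw [mem_ball_zero_iff] at hpδ
  rw [dist_zero_right] at hYδ
  have heq : ∀ t : Icc (0 : ℝ) 1, Y (ε, w) t =
      w + ε * ∫ s in (0 : ℝ)..t, F (ε * s, Y (ε, w) (projIcc 0 1 zero_le_one s)) := by
    intro t
    have h1 := DFunLike.congr_fun hp t
    simp only [Φ, ContinuousMap.sub_apply, ContinuousMap.smul_apply, primitiveCLM_apply, hconst,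
      ContinuousMap.zero_apply, smul_eq_mul] at h1
    have h2 := (hball ((ε, w), Y (ε, w)) (by
      rw [mem_ball_zero_iff, Prod.norm_def]; exact max_lt hpδ hYδ)).2
    have h3 : ∫ s in (0 : ℝ)..t, N (graph (ε, Y (ε, w))) (projIcc 0 1 zero_le_one s) =
        ∫ s in (0 : ℝ)..t, F (ε * s, Y (ε, w) (projIcc 0 1 zero_le_one s)) := by
      refine intervalIntegral.integral_congr fun s hs => ?_
      rw [uIcc_of_le t.2.1] at hs
      have := h2 (projIcc 0 1 zero_le_one s)
      simp only at this ⊢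
      rw [this, projIcc_of_mem zero_le_one ⟨hs.1, hs.2.trans t.2.2⟩]
    rw [h3] at h1
    linarith
  -- By uniqueness, the solution for the time `l * ε` is the rescaled solution for the time `ε`.
  have hscale : ∀ l : Icc (0 : ℝ) 1, φ (l * ε, w) = Y (ε, w) l := by
    intro l
    let ml : C(Icc (0 : ℝ) 1, Icc (0 : ℝ) 1) := ⟨fun t => l * t, by fun_prop⟩
    have hml : ∀ t, ((ml t : Icc (0 : ℝ) 1) : ℝ) = l * t := fun t => rfl
    have hmem : (((l * ε, w), (Y (ε, w)).comp ml) : (ℝ × ℝ) × C(Icc (0 : ℝ) 1, ℝ)) ∈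
        Metric.ball 0 δ := by
      rw [mem_ball_zero_iff, Prod.norm_def, Prod.norm_def]
      rw [Prod.norm_def, max_lt_iff] at hpδ
      refine max_lt (max_lt ?_ hpδ.2) ?_
      · refine lt_of_le_of_lt ?_ hpδ.1
        rw [norm_mul, Real.norm_of_nonneg l.2.1]
        exact mul_le_of_le_one_left (norm_nonneg _) l.2.2
      · refine lt_of_le_of_lt ?_ hYδ
        exact (ContinuousMap.norm_le _ (norm_nonneg _)).2 fun t => (Y (ε, w)).norm_coe_le_norm _
    obtain ⟨hu, hn⟩ := hball _ hmem
    have h0 : Φ ((l * ε, w), (Y (ε, w)).comp ml) = 0 := by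
      ext t
      simp only [Φ, ContinuousMap.sub_apply, ContinuousMap.smul_apply, primitiveCLM_apply, hconst,
        ContinuousMap.zero_apply, smul_eq_mul, ContinuousMap.comp_apply]
      have h3 : ∫ s in (0 : ℝ)..t, N (graph (l * ε, (Y (ε, w)).comp ml))
          (projIcc 0 1 zero_le_one s) =
          ∫ s in (0 : ℝ)..t, F (ε * (l * s), Y (ε, w) (projIcc 0 1 zero_le_one (l * s))) := by
        refine intervalIntegral.integral_congr fun s hs => ?_
        rw [uIcc_of_le t.2.1] at hs
        have hs1 : s ∈ Icc (0 : ℝ) 1 := ⟨hs.1, hs.2.trans t.2.2⟩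
        have := hn (projIcc 0 1 zero_le_one s)
        simp only at this ⊢
        rw [this, projIcc_of_mem zero_le_one hs1, ContinuousMap.comp_apply,
          projIcc_of_mem zero_le_one ⟨mul_nonneg l.2.1 hs1.1, mul_le_one₀ l.2.2 hs1.1 hs1.2⟩]
        congr 2
        simp only; ring
      have h4 := heq (ml t)
      have h5 := intervalIntegral.mul_integral_comp_mul_left (a := 0) (b := (t : ℝ))
        (f := fun s => F (ε * s, Y (ε, w) (projIcc 0 1 zero_le_one s))) (c := (l : ℝ))
      rw [mul_zero] at h5
      rw [h3, h4, hml, ← h5]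
      ring
    have h1 := hu h0
    have h2 := DFunLike.congr_fun h1 1
    simp only [ContinuousMap.comp_apply] at h2
    change Y (l * ε, w) 1 = _
    rw [h2]
    congr 1
    exact Subtype.ext (by rw [hml]; simp)
  have h1 := heq 1
  have h3 : ∫ s in (0 : ℝ)..(1 : Icc (0 : ℝ) 1),
      F (ε * s, Y (ε, w) (projIcc 0 1 zero_le_one s)) =
      ∫ s in (0 : ℝ)..1, F (ε * s, φ (ε * s, w)) := by
    refine intervalIntegral.integral_congr fun s hs => ?_
    rw [Icc.coe_one, uIcc_of_le zero_le_one] at hs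
    rw [projIcc_of_mem zero_le_one hs, ← hscale ⟨s, hs⟩, mul_comm ε s]
  have h5 := intervalIntegral.mul_integral_comp_mul_left (a := 0) (b := (1 : ℝ))
        (f := fun s => F (s, φ (s, w))) (c := ε)
  rw [h3, h5, mul_zero, mul_one] at h1
  exact h1

/-- Local analytic flow of a nonautonomous scalar analytic differential equation. -/
theorem AnalyticAt.exists_flow {F : ℝ × ℝ → ℝ} (hF : AnalyticAt ℝ F 0) :
    ∃ φ : ℝ × ℝ → ℝ, AnalyticAt ℝ φ 0 ∧ (∀ᶠ w in 𝓝 (0 : ℝ), φ (0, w) = w) ∧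
      ∀ᶠ q in 𝓝 (0 : ℝ × ℝ), HasDerivAt (fun u => φ (u, q.2)) (F (q.1, φ q)) q.1 := by
  obtain ⟨φ, hφ, hint⟩ := hF.exists_integral_flow
  have hi : Tendsto (fun w : ℝ => ((0 : ℝ), w)) (𝓝 0) (𝓝 0) := by
    have : Continuous fun w : ℝ => ((0 : ℝ), w) := by fun_prop
    exact this.tendsto 0
  have h0 : ∀ᶠ w in 𝓝 (0 : ℝ), φ (0, w) = w := by
    filter_upwards [hi.eventually hint] with w hw
    simpa using hw
  have hφ0 : φ 0 = 0 := h0.self_of_nhds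
  have hpair : AnalyticAt ℝ (fun q : ℝ × ℝ => (q.1, φ q)) 0 := analyticAt_fst.prod hφ
  have hcomp : AnalyticAt ℝ (fun q : ℝ × ℝ => F (q.1, φ q)) 0 := by
    refine AnalyticAt.fun_comp (g := F) ?_ hpair
    rw [hφ0]; exact hF
  refine ⟨φ, hφ, h0, ?_⟩
  obtain ⟨δ, hδ, hball⟩ := Metric.eventually_nhds_iff_ball.1
    (hint.and hcomp.eventually_continuousAt)
  filter_upwards [Metric.ball_mem_nhds (0 : ℝ × ℝ) hδ] with q hq
  obtain ⟨u, w⟩ := q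
  rw [mem_ball_zero_iff, Prod.norm_def, max_lt_iff] at hq
  have hmem : ∀ s : ℝ, |s| < δ → ((s, w) : ℝ × ℝ) ∈ Metric.ball (0 : ℝ × ℝ) δ := fun s hs => by
    rw [mem_ball_zero_iff, Prod.norm_def]; exact max_lt hs hq.2
  have hcs : ∀ s : ℝ, |s| < δ → ContinuousAt (fun s => F (s, φ (s, w))) s := fun s hs =>
    ContinuousAt.comp (f := fun s : ℝ => (s, w)) (hball _ (hmem s hs)).2 (by fun_prop)
  have hop : IsOpen {s : ℝ | |s| < δ} := isOpen_lt continuous_abs continuous_const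
  have hd : HasDerivAt (fun u => ∫ s in (0 : ℝ)..u, F (s, φ (s, w))) (F (u, φ (u, w))) u := by
    refine intervalIntegral.integral_hasDerivAt_right ?_ ?_ (hcs u hq.1)
    · refine ContinuousOn.intervalIntegrable fun s hs => (hcs s ?_).continuousWithinAt
      have := abs_sub_left_of_mem_uIcc hs
      rw [sub_zero, sub_zero] at this
      exact this.trans_lt hq.1
    · exact ContinuousOn.stronglyMeasurableAtFilter hop
        (fun s hs => (hcs s hs).continuousWithinAt) u hq.1
  refine (hd.const_add w).congr_of_eventuallyEq ?_
  filter_upwards [hop.mem_nhds hq.1] with s hs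
  exact (hball _ (hmem s hs)).1

theorem ContinuousLinearMap.isInvertible_of_forall_eq_zero {A : (ℝ × ℝ) →L[ℝ] (ℝ × ℝ)}
    (h : ∀ v, A v = 0 → v = 0) : A.IsInvertible := by
  have hinj : Function.Injective (A : (ℝ × ℝ) →ₗ[ℝ] (ℝ × ℝ)) :=
    (injective_iff_map_eq_zero _).2 h
  exact ⟨(LinearEquiv.ofInjectiveEndo _ hinj).toContinuousLinearEquiv, by ext <;> rfl⟩

theorem AnalyticAt.eventually_hasFDerivAt {E G : Type*} [NormedAddCommGroup E] [NormedSpace ℝ E]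
    [NormedAddCommGroup G] [NormedSpace ℝ G] [CompleteSpace G] {f : E → G} {x : E}
    (hf : AnalyticAt ℝ f x) : ∀ᶠ y in 𝓝 x, HasFDerivAt f (fderiv ℝ f y) y :=
  hf.eventually_analyticAt.mono fun _ h => h.differentiableAt.hasFDerivAt

theorem clm_apply_eq_add {G : Type*} [NormedAddCommGroup G] [NormedSpace ℝ G]
    (A : (ℝ × ℝ) →L[ℝ] G) (v : ℝ × ℝ) : A v = v.1 • A (1, 0) + v.2 • A (0, 1) := by
  rw [← map_smul, ← map_smul, ← map_add]
  simp

/-- An analytic direction field `∂/∂u + F ∂/∂w` has an analytic first integral, namely the height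
at which the integral curve through `(u, w)` meets the axis `u = 0`. -/
theorem AnalyticAt.exists_first_integral {F : ℝ × ℝ → ℝ} (hF : AnalyticAt ℝ F 0) :
    ∃ C : ℝ × ℝ → ℝ, AnalyticAt ℝ C 0 ∧ (∀ᶠ w in 𝓝 (0 : ℝ), C (0, w) = w) ∧
      ∀ᶠ q in 𝓝 (0 : ℝ × ℝ), fderiv ℝ C q (1, F q) = 0 := by
  obtain ⟨φ, hφ, hφ0, hφd⟩ := hF.exists_flow
  let G : ℝ × ℝ → ℝ × ℝ := fun q => (q.1, φ q)
  have hG : AnalyticAt ℝ G 0 := analyticAt_fst.prod hφ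
  have hG0 : G 0 = 0 := Prod.ext rfl hφ0.self_of_nhds
  have hfd : ∀ q, DifferentiableAt ℝ φ q → HasFDerivAt G
      ((ContinuousLinearMap.fst ℝ ℝ ℝ).prod (fderiv ℝ φ q)) q := fun q hq =>
    hasFDerivAt_fst.prodMk hq.hasFDerivAt
  have h01 : fderiv ℝ φ 0 (0, 1) = 1 := by
    have h1 : HasDerivAt (fun w : ℝ => φ (0, w)) (fderiv ℝ φ 0 (0, 1)) 0 := by
      have h2 : HasDerivAt (fun w : ℝ => ((0 : ℝ), w)) (0, 1) 0 :=
        (hasDerivAt_const _ _).prodMk (hasDerivAt_id _)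
      exact HasFDerivAt.comp_hasDerivAt (0 : ℝ) hφ.differentiableAt.hasFDerivAt h2
    exact h1.unique ((hasDerivAt_id (0 : ℝ)).congr_of_eventuallyEq hφ0)
  have hinv : (fderiv ℝ G 0).IsInvertible := by
    rw [(hfd 0 hφ.differentiableAt).fderiv]
    refine ContinuousLinearMap.isInvertible_of_forall_eq_zero fun v hv => ?_
    have h1 : v.1 = 0 := congrArg Prod.fst hv
    have h2 : fderiv ℝ φ 0 v = 0 := congrArg Prod.snd hv
    rw [clm_apply_eq_add, h1, h01] at h2
    exact Prod.ext h1 (by simpa using h2)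
  obtain ⟨h, h0, -, hh, -, hs⟩ := hG.exists_openPartialHomeomorph hinv univ_mem
  have h0t : (0 : ℝ × ℝ) ∈ h.target := by
    have := h.map_source h0
    rwa [hh, hG0] at this
  have hs0 : h.symm 0 = 0 := by
    have := h.left_inv h0
    rwa [hh, hG0] at this
  have hCa : ∀ y ∈ h.target, AnalyticAt ℝ (fun q => (h.symm q).2) y := fun y hy =>
    AnalyticAt.fun_comp (g := Prod.snd) analyticAt_snd (hs y hy)
  refine ⟨fun q => (h.symm q).2, hCa 0 h0t, ?_, ?_⟩
  · have hi : Tendsto (fun w : ℝ => ((0 : ℝ), w)) (𝓝 0) (𝓝 0) := by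
      have : Continuous fun w : ℝ => ((0 : ℝ), w) := by fun_prop
      exact this.tendsto 0
    filter_upwards [hφ0, hi.eventually (h.open_source.mem_nhds h0)] with w hw hws
    have := h.left_inv hws
    rw [hh] at this
    simp only [G, hw] at this
    rw [this]
  · have hst : Tendsto h.symm (𝓝 0) (𝓝 0) := by
      have := (hs 0 h0t).continuousAt.tendsto
      rwa [hs0] at this
    filter_upwards [h.open_target.mem_nhds h0t, hst.eventually hφd,
      hst.eventually hφ.eventually_analyticAt] with q hq hd ha
    set p := h.symm q with hp
    have hps : p ∈ h.source := h.map_target hq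
    have hGp : G p = q := by rw [← hh]; exact h.right_inv hq
    have hd1 : fderiv ℝ φ p (1, 0) = F q := by
      have h2 : HasDerivAt (fun u : ℝ => (u, p.2)) (1, 0) p.1 :=
        (hasDerivAt_id _).prodMk (hasDerivAt_const _ _)
      have h3 : HasDerivAt (fun u : ℝ => φ (u, p.2)) (fderiv ℝ φ p (1, 0)) p.1 :=
        HasFDerivAt.comp_hasDerivAt (f := fun u : ℝ => (u, p.2)) p.1
          ha.differentiableAt.hasFDerivAt h2
      rw [h3.unique hd, ← hGp]
    have hc := ((hCa q hq).differentiableAt.hasFDerivAt)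
    rw [← hGp] at hc
    have hc2 := hc.comp p (hfd p ha.differentiableAt)
    have hc3 : HasFDerivAt ((fun q => (h.symm q).2) ∘ G) (ContinuousLinearMap.snd ℝ ℝ ℝ) p := by
      refine hasFDerivAt_snd.congr_of_eventuallyEq ?_
      filter_upwards [h.open_source.mem_nhds hps] with y hy
      have := h.left_inv hy
      rw [hh] at this
      simp [this]
    have := DFunLike.congr_fun (hc2.unique hc3) (1, 0)
    rw [hGp] at this
    simpa [hd1] using this

theorem AnalyticAt.dslope_self {f : ℝ → ℝ} {x : ℝ} (hf : AnalyticAt ℝ f x) :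
    AnalyticAt ℝ (dslope f x) x :=
  hf.elim fun _ hp => hp.has_fpower_series_dslope_fslope.analyticAt

theorem AnalyticAt.exists_eq_sq_mul {f : ℝ → ℝ} (hf : AnalyticAt ℝ f 0) (h0 : f 0 = 0)
    (h1 : deriv f 0 = 0) : ∃ A : ℝ → ℝ, AnalyticAt ℝ A 0 ∧ (∀ u, f u = u ^ 2 * A u) ∧
      deriv (deriv f) 0 = 2 * A 0 := by
  have hA : AnalyticAt ℝ (dslope (dslope f 0) 0) 0 := hf.dslope_self.dslope_self
  have hfA : ∀ u, f u = u ^ 2 * dslope (dslope f 0) 0 u := by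
    intro u
    have e1 := sub_smul_dslope f 0 u
    have e2 := sub_smul_dslope (dslope f 0) 0 u
    rw [dslope_same, h1] at e2
    simp only [sub_zero, smul_eq_mul, h0] at e1 e2
    rw [← e1, ← e2]; ring
  refine ⟨_, hA, hfA, ?_⟩
  set A := dslope (dslope f 0) 0
  have hd : deriv f =ᶠ[𝓝 0] fun u => 2 * u * A u + u ^ 2 * deriv A u := by
    filter_upwards [hA.eventually_analyticAt] with u hu
    rw [show f = fun u => u ^ 2 * A u from funext hfA]
    have := (hasDerivAt_pow 2 u).fun_mul hu.differentiableAt.hasDerivAt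
    simpa using this.deriv
  rw [hd.deriv_eq]
  have h2 : HasDerivAt (fun u => 2 * u * A u + u ^ 2 * deriv A u) (2 * A 0) 0 := by
    have := (((hasDerivAt_id (0 : ℝ)).const_mul 2).fun_mul hA.differentiableAt.hasDerivAt).fun_add
      ((hasDerivAt_pow 2 (0 : ℝ)).fun_mul hA.deriv.differentiableAt.hasDerivAt)
    simpa using this
  exact h2.deriv

/-! ### Reversible fields and orbital normal form -/

/-- The infinitesimal generator of the clockwise rotations. -/
def rotField (q : ℝ × ℝ) : ℝ × ℝ := (q.2, -q.1)

theorem tendsto_fold : Tendsto (fun z : ℝ × ℝ => (z.1, z.2 ^ 2)) (𝓝 0) (𝓝 0) := by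
  have : Continuous fun z : ℝ × ℝ => (z.1, z.2 ^ 2) := by fun_prop
  exact this.tendsto' 0 0 (by ext <;> simp)

theorem AnalyticAt.comp_fold {G : Type*} [NormedAddCommGroup G] [NormedSpace ℝ G] {f : ℝ × ℝ → G}
    (hf : AnalyticAt ℝ f 0) : AnalyticAt ℝ (fun z : ℝ × ℝ => f (z.1, z.2 ^ 2)) 0 := by
  exact AnalyticAt.fun_comp_of_eq (g := f) hf (analyticAt_fst.prod (analyticAt_snd.pow 2))
    (by ext <;> simp)

/-- A field reversible under `(u, v) ↦ (u, -v)` has the form `(v p(u, v²), q(u, v²))`. -/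
theorem IsReversibleOn.exists_fold {X : ℝ × ℝ → ℝ × ℝ} {Ω : Set (ℝ × ℝ)} (hΩ : Ω ∈ 𝓝 0)
    (hX : AnalyticAt ℝ X 0) (hrev : IsReversibleOn reflectionR X Ω) :
    ∃ p q : ℝ × ℝ → ℝ, AnalyticAt ℝ p 0 ∧ AnalyticAt ℝ q 0 ∧
      ∀ᶠ z in 𝓝 (0 : ℝ × ℝ), X z = (z.2 * p (z.1, z.2 ^ 2), q (z.1, z.2 ^ 2)) := by
  have hR : Tendsto (fun z : ℝ × ℝ => (z.1, -z.2)) (𝓝 0) (𝓝 0) := by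
    have : Continuous fun z : ℝ × ℝ => (z.1, -z.2) := by fun_prop
    exact this.tendsto' 0 0 (by ext <;> simp)
  have hRa : AnalyticAt ℝ (fun z : ℝ × ℝ => (z.1, -z.2)) 0 := analyticAt_fst.prod analyticAt_snd.neg
  have hsym : ∀ᶠ z in 𝓝 (0 : ℝ × ℝ),
      (X (z.1, -z.2)).1 = -(X z).1 ∧ (X (z.1, -z.2)).2 = (X z).2 := by
    filter_upwards [hΩ, hR.eventually hΩ] with z hz hz'
    have h := hrev z hz hz'
    simp only [reflectionR_apply] at h
    have h1 := congrArg Prod.fst h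
    have h2 := congrArg Prod.snd h
    simp only [Prod.fst_neg, Prod.snd_neg] at h1 h2
    constructor <;> linarith
  have hP : AnalyticAt ℝ (fun z => (X z).1) 0 :=
    AnalyticAt.fun_comp (g := Prod.fst) analyticAt_fst hX
  have hQ : AnalyticAt ℝ (fun z => (X z).2) 0 :=
    AnalyticAt.fun_comp (g := Prod.snd) analyticAt_snd hX
  obtain ⟨q, hq, hqe⟩ := hQ.exists_eq_comp_sq (hsym.mono fun z hz => hz.2)
  obtain ⟨g, hg, hge⟩ := hP.exists_eq_add_snd_mul
  have hax : Tendsto (fun z : ℝ × ℝ => (z.1, (0 : ℝ))) (𝓝 0) (𝓝 0) := by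
    have : Continuous fun z : ℝ × ℝ => (z.1, (0 : ℝ)) := by fun_prop
    exact this.tendsto' 0 0 (by ext <;> simp)
  have hPg : ∀ᶠ z in 𝓝 (0 : ℝ × ℝ), (X z).1 = z.2 * g z := by
    filter_upwards [hge, hax.eventually hsym] with z hz hz'
    have h1 := hz'.1
    simp only [neg_zero] at h1
    rw [hz]
    linarith
  have hgR : AnalyticAt ℝ (fun z : ℝ × ℝ => g (z.1, -z.2)) 0 := by
    exact AnalyticAt.fun_comp_of_eq (g := g) hg hRa (by ext <;> simp)
  have heven : ∀ᶠ z in 𝓝 (0 : ℝ × ℝ), g (z.1, -z.2) - g z = 0 := by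
    refine eventually_eq_zero_of_snd_mul (hgR.sub hg) ?_
    filter_upwards [hPg, hR.eventually hPg, hsym] with z h1 h2 h3
    have := h3.1
    change z.2 * (g (z.1, -z.2) - g z) = 0
    linarith
  obtain ⟨p, hp, hpe⟩ := hg.exists_eq_comp_sq (heven.mono fun z hz => sub_eq_zero.1 hz)
  refine ⟨p, q, hp, hq, ?_⟩
  filter_upwards [hPg, hpe, hqe] with z h1 h2 h3
  exact Prod.ext (by rw [h1, h2]) h3

/-- Near a nondegenerate monodromic singularity, the field `(v p(u, v²), q(u, v²))` becomes a
positive or negative multiple `1 / m` of the rotation field. The first integral of the folded field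
has the form `u² A(u) + w B(u, w)` with `A, B > 0`, so that `(u √A, v √B)` takes its level sets to
circles. -/
theorem exists_orbital_normal_form {p q : ℝ × ℝ → ℝ} (hp : AnalyticAt ℝ p 0)
    (hq : AnalyticAt ℝ q 0) (hq0 : q 0 = 0) (hpq : p 0 * fderiv ℝ q 0 (1, 0) < 0)
    {X : ℝ × ℝ → ℝ × ℝ}
    (hX : ∀ᶠ z in 𝓝 (0 : ℝ × ℝ), X z = (z.2 * p (z.1, z.2 ^ 2), q (z.1, z.2 ^ 2))) :
    ∃ (H : ℝ × ℝ → ℝ × ℝ) (m : ℝ × ℝ → ℝ), AnalyticAt ℝ H 0 ∧ H 0 = 0 ∧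
      (fderiv ℝ H 0).IsInvertible ∧ AnalyticAt ℝ m 0 ∧ m 0 ≠ 0 ∧
      ∀ᶠ z in 𝓝 (0 : ℝ × ℝ), m (H z) • fderiv ℝ H z (X z) = rotField (H z) := by
  have hp0 : p 0 ≠ 0 := by rintro h; simp [h] at hpq
  set F : ℝ × ℝ → ℝ := fun z => 2 * q z / p z with hFdef
  have hF : AnalyticAt ℝ F 0 := (analyticAt_const.mul hq).div hp hp0
  have hF0 : F 0 = 0 := by simp [F, hq0]
  obtain ⟨C, hC, hCw, hCF⟩ := hF.exists_first_integral
  have hC0 : C 0 = 0 := hCw.self_of_nhds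
  have hvert : HasDerivAt (fun w : ℝ => ((0 : ℝ), w)) (0, 1) 0 :=
    (hasDerivAt_const _ _).prodMk (hasDerivAt_id _)
  have hhor : ∀ u, HasDerivAt (fun u : ℝ => (u, (0 : ℝ))) (1, 0) u := fun u =>
    (hasDerivAt_id _).prodMk (hasDerivAt_const _ _)
  have htax : Tendsto (fun u : ℝ => (u, (0 : ℝ))) (𝓝 0) (𝓝 0) :=
    (hhor 0).continuousAt.tendsto
  have hC01 : fderiv ℝ C 0 (0, 1) = 1 := by
    have h1 : HasDerivAt (fun w : ℝ => C (0, w)) (fderiv ℝ C 0 (0, 1)) 0 :=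
      HasFDerivAt.comp_hasDerivAt (0 : ℝ) hC.differentiableAt.hasFDerivAt hvert
    exact h1.unique ((hasDerivAt_id (0 : ℝ)).congr_of_eventuallyEq hCw)
  have hC10 : ∀ᶠ z in 𝓝 (0 : ℝ × ℝ), fderiv ℝ C z (1, 0) = -(F z * fderiv ℝ C z (0, 1)) := by
    filter_upwards [hCF] with z hz
    rw [clm_apply_eq_add] at hz
    simp only [one_mul, smul_eq_mul] at hz
    linarith
  -- On the axis `w = 0` the first integral vanishes to second order, with a positive coefficient.
  set c₀ : ℝ → ℝ := fun u => C (u, 0) with hc₀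
  have hc₀a : AnalyticAt ℝ c₀ 0 :=
    AnalyticAt.fun_comp_of_eq (g := C) hC (analyticAt_id.prod analyticAt_const) rfl
  have hc₀d : deriv c₀ =ᶠ[𝓝 0] fun u => -(F (u, 0) * fderiv ℝ C (u, 0) (0, 1)) := by
    filter_upwards [htax.eventually hC.eventually_hasFDerivAt, htax.eventually hC10] with u h1 h2
    rw [← h2]
    exact (h1.comp_hasDerivAt u (hhor u)).deriv
  have hq1 : HasDerivAt (fun u : ℝ => q (u, 0)) (fderiv ℝ q 0 (1, 0)) 0 :=
    HasFDerivAt.comp_hasDerivAt (0 : ℝ) hq.differentiableAt.hasFDerivAt (hhor 0)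
  have hp1 : HasDerivAt (fun u : ℝ => p (u, 0)) (fderiv ℝ p 0 (1, 0)) 0 :=
    HasFDerivAt.comp_hasDerivAt (0 : ℝ) hp.differentiableAt.hasFDerivAt (hhor 0)
  have hCw1 : HasDerivAt (fun u : ℝ => fderiv ℝ C (u, 0) (0, 1))
      (fderiv ℝ (fun z => fderiv ℝ C z (0, 1)) 0 (1, 0)) 0 :=
    HasFDerivAt.comp_hasDerivAt (f := fun u : ℝ => (u, (0 : ℝ))) (0 : ℝ)
      (hC.fderiv_apply_const (0, 1)).differentiableAt.hasFDerivAt (hhor 0)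
  have hz0 : ((0 : ℝ), (0 : ℝ)) = 0 := rfl
  have hF1 : HasDerivAt (fun u : ℝ => F (u, 0)) (2 * fderiv ℝ q 0 (1, 0) / p 0) 0 := by
    have := (hq1.const_mul 2).fun_div hp1 (by rw [hz0]; exact hp0)
    rw [hz0, hq0] at this
    convert! this using 1
    field_simp
    ring
  obtain ⟨A, hA, hcA, hA2⟩ := hc₀a.exists_eq_sq_mul hC0 (by
    rw [hc₀d.self_of_nhds]
    simp only [hz0, hF0, zero_mul, neg_zero])
  have hA0 : A 0 = -(fderiv ℝ q 0 (1, 0) / p 0) := by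
    rw [hc₀d.deriv_eq] at hA2
    have h1 := (hF1.fun_mul hCw1).fun_neg.deriv
    rw [h1, hz0, hC01, hF0] at hA2
    linear_combination (-1 / 2) * hA2
  have hA0pos : 0 < A 0 := by
    rw [hA0, show -(fderiv ℝ q 0 (1, 0) / p 0) = -(p 0 * fderiv ℝ q 0 (1, 0)) / p 0 ^ 2 by
      field_simp]
    have : 0 < p 0 ^ 2 := by positivity
    exact div_pos (by linarith) this
  obtain ⟨B, hB, hCB⟩ := hC.exists_eq_add_snd_mul
  have hB0 : B 0 = 1 := by
    have h1 : HasDerivAt (fun w : ℝ => B (0, w)) (fderiv ℝ B 0 (0, 1)) 0 :=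
      HasFDerivAt.comp_hasDerivAt (0 : ℝ) hB.differentiableAt.hasFDerivAt hvert
    have h2 := (hasDerivAt_id (0 : ℝ)).fun_mul h1
    have h3 : (fun w : ℝ => w) =ᶠ[𝓝 0] fun w => id w * B (0, w) := by
      filter_upwards [hvert.continuousAt.tendsto.eventually hCB, hCw] with w h4 h5
      simp only [hz0, hC0, h5, zero_add] at h4
      exact h4
    have h6 := (h2.congr_of_eventuallyEq h3).unique (hasDerivAt_id (0 : ℝ))
    rw [hz0] at h6
    simpa using h6
  set s : ℝ × ℝ → ℝ := fun z => √(B (z.1, z.2 ^ 2)) with hsdef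
  have hBf : AnalyticAt ℝ (fun z : ℝ × ℝ => B (z.1, z.2 ^ 2)) 0 := hB.comp_fold
  have hs0 : s 0 = 1 := by
    have : B ((0 : ℝ × ℝ).1, (0 : ℝ × ℝ).2 ^ 2) = 1 := by
      rw [← hB0]; congr 1; ext <;> simp
    simp only [hsdef]
    rw [this, Real.sqrt_one]
  have hBpos : ∀ᶠ z in 𝓝 (0 : ℝ × ℝ), 0 < B (z.1, z.2 ^ 2) := by
    refine tendsto_fold.eventually (hB.continuousAt.eventually (lt_mem_nhds ?_))
    rw [hB0]; exact one_pos
  have hs : AnalyticAt ℝ s 0 := (hBf.contDiffAt.sqrt hBpos.self_of_nhds.ne').analyticAt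
  set α : ℝ → ℝ := fun u => u * √(A u) with hαdef
  have hsA : AnalyticAt ℝ (fun u => √(A u)) 0 := (hA.contDiffAt.sqrt hA0pos.ne').analyticAt
  have hα : AnalyticAt ℝ α 0 := analyticAt_id.mul hsA
  have hα1 : deriv α 0 = √(A 0) := by
    have := (hasDerivAt_id (0 : ℝ)).fun_mul hsA.differentiableAt.hasDerivAt
    simpa using this.deriv
  have hAsq : 0 < √(A 0) := Real.sqrt_pos.2 hA0pos
  have hα0 : α 0 = 0 := by simp [α]
  have hfst : Tendsto (fun z : ℝ × ℝ => z.1) (𝓝 0) (𝓝 0) := continuous_fst.tendsto' _ _ rfl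
  have hAn : ∀ {f : ℝ → ℝ}, AnalyticAt ℝ f 0 → AnalyticAt ℝ (fun z : ℝ × ℝ => f z.1) 0 :=
    fun hf => AnalyticAt.fun_comp_of_eq hf analyticAt_fst rfl
  set H : ℝ × ℝ → ℝ × ℝ := fun z => (α z.1, z.2 * s z) with hHdef
  have hHa : AnalyticAt ℝ H 0 := (hAn hα).prod (analyticAt_snd.mul hs)
  have hH0 : H 0 = 0 := by ext <;> simp [H, hα0]
  have hHd : ∀ᶠ z in 𝓝 (0 : ℝ × ℝ), ∀ v : ℝ × ℝ, fderiv ℝ H z v =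
      (v.1 * deriv α z.1, z.2 * fderiv ℝ s z v + s z * v.2) := by
    filter_upwards [hfst.eventually hα.eventually_analyticAt, hs.eventually_hasFDerivAt]
      with z h1 h2 v
    have h3 : HasFDerivAt (fun z : ℝ × ℝ => α z.1) _ z :=
      HasFDerivAt.comp z h1.differentiableAt.hasFDerivAt hasFDerivAt_fst
    have h4 := h3.prodMk ((hasFDerivAt_snd (𝕜 := ℝ) (p := z)).fun_mul h2)
    rw [h4.fderiv]
    simp [mul_comm]
  have hHinv : (fderiv ℝ H 0).IsInvertible := by
    refine ContinuousLinearMap.isInvertible_of_forall_eq_zero fun v hv => ?_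
    rw [hHd.self_of_nhds, hs0] at hv
    have h1 := congrArg Prod.fst hv
    have h2 := congrArg Prod.snd hv
    simp only [Prod.fst_zero, Prod.snd_zero, hα1, zero_mul, zero_add, one_mul, mul_eq_zero,
      hAsq.ne', or_false] at h1 h2
    exact Prod.ext h1 h2
  set g : ℝ × ℝ → ℝ := fun z => deriv α z.1 * p (z.1, z.2 ^ 2) / s z with hgdef
  have hpf : AnalyticAt ℝ (fun z : ℝ × ℝ => p (z.1, z.2 ^ 2)) 0 := hp.comp_fold
  have hqf : AnalyticAt ℝ (fun z : ℝ × ℝ => q (z.1, z.2 ^ 2)) 0 := hq.comp_fold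
  have hga : AnalyticAt ℝ g 0 := ((hAn hα.deriv).mul hpf).div hs (by rw [hs0]; exact one_ne_zero)
  have hg0 : g 0 ≠ 0 := by
    have : p ((0 : ℝ × ℝ).1, (0 : ℝ × ℝ).2 ^ 2) = p 0 := by congr 1; ext <;> simp
    simp only [hgdef]
    rw [this, hs0, div_one, Prod.fst_zero, hα1]
    exact mul_ne_zero hAsq.ne' hp0
  have hspos : ∀ᶠ z in 𝓝 (0 : ℝ × ℝ), 0 < s z := hBpos.mono fun z hz => Real.sqrt_pos.2 hz
  have hfirst : ∀ᶠ z in 𝓝 (0 : ℝ × ℝ), (fderiv ℝ H z (X z)).1 = g z * (H z).2 := by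
    filter_upwards [hHd, hX, hspos] with z h1 h2 h3
    rw [h1, h2]
    simp only [hgdef, hHdef]
    field_simp
  -- In the new coordinates the first integral is the squared radius.
  have hcirc : ∀ᶠ z in 𝓝 (0 : ℝ × ℝ), (H z).1 ^ 2 + (H z).2 ^ 2 = C (z.1, z.2 ^ 2) := by
    have hApos : ∀ᶠ u in 𝓝 (0 : ℝ), 0 < A u := hA.continuousAt.eventually (lt_mem_nhds hA0pos)
    filter_upwards [tendsto_fold.eventually hCB, hBpos, hfst.eventually hApos] with z h1 h2 h3
    rw [h1]
    simp only [hHdef, hαdef, hsdef, mul_pow]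
    rw [Real.sq_sqrt h2.le, Real.sq_sqrt h3.le]
    have := hcA z.1
    simp only [hc₀] at this
    rw [this]
  -- The second component follows from the first because the squared radius is a first integral.
  have hsecond : ∀ᶠ z in 𝓝 (0 : ℝ × ℝ), (fderiv ℝ H z (X z)).2 = -(g z * (H z).1) := by
    set c : ℝ × ℝ → ℝ := fun z => (z.2 * p (z.1, z.2 ^ 2) * (fderiv ℝ H z (1, 0)).2 +
      q (z.1, z.2 ^ 2) * (fderiv ℝ H z (0, 1)).2) + g z * α z.1 with hcdef
    have hsndA : ∀ v, AnalyticAt ℝ (fun z => (fderiv ℝ H z v).2) 0 := fun v =>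
      AnalyticAt.fun_comp (g := Prod.snd) analyticAt_snd (hHa.fderiv_apply_const v)
    have hca : AnalyticAt ℝ c 0 :=
      (((analyticAt_snd.mul hpf).mul (hsndA _)).add (hqf.mul (hsndA _))).add (hga.mul (hAn hα))
    have hcX : ∀ᶠ z in 𝓝 (0 : ℝ × ℝ), (fderiv ℝ H z (X z)).2 = c z - g z * α z.1 := by
      filter_upwards [hX] with z hz
      rw [hz, clm_apply_eq_add]
      simp [hcdef]
    have hzero : ∀ᶠ z in 𝓝 (0 : ℝ × ℝ), z.2 * (s z * c z) = 0 := by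
      have hpne : ∀ᶠ z in 𝓝 (0 : ℝ × ℝ), p z ≠ 0 := hp.continuousAt.eventually_ne hp0
      filter_upwards [hcirc.eventually_nhds, hcX, hfirst, hX, hHa.eventually_hasFDerivAt,
        tendsto_fold.eventually hC.eventually_hasFDerivAt, tendsto_fold.eventually hCF,
        tendsto_fold.eventually hpne] with z h1 h2 h3 h4 h5 h6 h7 h8
      have d1 := (h5.fst.pow 2).add (h5.snd.pow 2)
      have hfold : HasFDerivAt (fun z : ℝ × ℝ => (z.1, z.2 ^ 2)) _ z :=
        (hasFDerivAt_fst (𝕜 := ℝ) (p := z)).prodMk ((hasFDerivAt_snd (𝕜 := ℝ) (p := z)).pow 2)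
      have d2 := h6.comp z hfold
      have d3 := d1.unique (d2.congr_of_eventuallyEq h1)
      have d4 := DFunLike.congr_fun d3 (X z)
      have h9 : fderiv ℝ C (z.1, z.2 ^ 2)
          (z.2 * p (z.1, z.2 ^ 2), 2 * z.2 * q (z.1, z.2 ^ 2)) = 0 := by
        have : ((z.2 * p (z.1, z.2 ^ 2), 2 * z.2 * q (z.1, z.2 ^ 2)) : ℝ × ℝ) =
            (z.2 * p (z.1, z.2 ^ 2)) • (1, F (z.1, z.2 ^ 2)) := by
          simp only [hFdef, Prod.smul_mk, smul_eq_mul, mul_one]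
          congr 1
          field_simp
        rw [this, map_smul, h7, smul_zero]
      have h10 : (H z).1 * (fderiv ℝ H z (X z)).1 + (H z).2 * (fderiv ℝ H z (X z)).2 = 0 := by
        have e : fderiv ℝ C (z.1, z.2 ^ 2) ((X z).1, 2 * z.2 * (X z).2) = 0 := by
          rw [h4]; exact h9
        simp at d4
        rw [e] at d4
        linarith
      rw [h3, h2] at h10
      simp only [hHdef] at h10
      linear_combination h10
    have := eventually_eq_zero_of_snd_mul (hs.mul hca) hzero
    filter_upwards [this, hcX, hspos] with z h1 h2 h3
    have h4 : c z = 0 := (mul_eq_zero.1 h1).resolve_left h3.ne'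
    rw [h2, h4, zero_sub]
  obtain ⟨h, h0, -, hh, -, hsy⟩ := hHa.exists_openPartialHomeomorph hHinv univ_mem
  have h0t : (0 : ℝ × ℝ) ∈ h.target := by
    have := h.map_source h0
    rwa [hh, hH0] at this
  have hs0' : h.symm 0 = 0 := by
    have := h.left_inv h0
    rwa [hh, hH0] at this
  refine ⟨H, fun y => (g (h.symm y))⁻¹, hHa, hH0, hHinv, ?_, ?_, ?_⟩
  · have : AnalyticAt ℝ (fun y => g (h.symm y)) 0 :=
      AnalyticAt.fun_comp_of_eq hga (hsy 0 h0t) hs0'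
    exact this.inv (by rw [hs0']; exact hg0)
  · simp only
    rw [hs0']
    exact inv_ne_zero hg0
  · filter_upwards [hfirst, hsecond, h.open_source.mem_nhds h0,
      hga.continuousAt.eventually_ne hg0] with z h1 h2 h3 h4
    have h5 : h.symm (H z) = z := by rw [← hh]; exact h.left_inv h3
    simp only [h5]
    ext
    · rw [Prod.smul_fst, h1, rotField, smul_eq_mul]
      field_simp
    · rw [Prod.smul_snd, h2, rotField, smul_eq_mul]
      field_simp

/-! ### Twisting along the rotation flow -/

/-- The clockwise rotation by the angle `t`, which is the time-`t` flow of `rotField`. -/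
noncomputable def rot (t : ℝ) : (ℝ × ℝ) →L[ℝ] (ℝ × ℝ) :=
  Real.cos t • ContinuousLinearMap.id ℝ (ℝ × ℝ) +
    Real.sin t • (ContinuousLinearMap.snd ℝ ℝ ℝ).prod (-ContinuousLinearMap.fst ℝ ℝ ℝ)

theorem rot_apply (t : ℝ) (q : ℝ × ℝ) :
    rot t q = (Real.cos t * q.1 + Real.sin t * q.2, Real.cos t * q.2 - Real.sin t * q.1) := by
  ext <;> simp [rot, sub_eq_add_neg]

theorem rot_zero (q : ℝ × ℝ) : rot 0 q = q := by simp [rot_apply]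

theorem rot_add (s t : ℝ) (q : ℝ × ℝ) : rot (s + t) q = rot s (rot t q) := by
  simp only [rot_apply, Real.cos_add, Real.sin_add]
  ext <;> simp only <;> ring

theorem rot_add_two_pi (t : ℝ) (q : ℝ × ℝ) : rot (t + 2 * Real.pi) q = rot t q := by
  simp [rot_apply]

theorem continuous_rot : Continuous rot := by
  unfold rot
  fun_prop

theorem hasDerivAt_rot (q : ℝ × ℝ) (t : ℝ) :
    HasDerivAt (fun t => rot t q) (rotField (rot t q)) t := by
  have h1 := ((Real.hasDerivAt_cos t).mul_const q.1).fun_add ((Real.hasDerivAt_sin t).mul_const q.2)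
  have h2 := ((Real.hasDerivAt_cos t).mul_const q.2).fun_sub ((Real.hasDerivAt_sin t).mul_const q.1)
  have h3 : HasDerivAt (fun t => rot t q) _ t :=
    (h1.prodMk h2).congr_of_eventuallyEq (Eventually.of_forall fun t => rot_apply t q)
  convert! h3 using 1
  rw [rot_apply]
  ext <;> simp only [rotField] <;> ring

theorem norm_rot_le (t : ℝ) (q : ℝ × ℝ) : ‖rot t q‖ ≤ 2 * ‖q‖ := by
  have hc := Real.abs_cos_le_one t
  have hs := Real.abs_sin_le_one t
  have h1 : ∀ a b x y : ℝ, |a| ≤ 1 → |b| ≤ 1 → |x| ≤ ‖q‖ → |y| ≤ ‖q‖ →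
      |a * x + b * y| ≤ 2 * ‖q‖ := by
    intro a b x y ha hb hx hy
    calc |a * x + b * y| ≤ |a| * |x| + |b| * |y| := by
          rw [← abs_mul, ← abs_mul]; exact abs_add_le _ _
      _ ≤ 1 * ‖q‖ + 1 * ‖q‖ := by gcongr
      _ = 2 * ‖q‖ := by ring
  rw [rot_apply, Prod.norm_def]
  refine max_le (h1 _ _ _ _ hc hs (norm_fst_le q) (norm_snd_le q)) ?_
  have := h1 _ (-Real.sin t) _ _ hc (by rwa [abs_neg]) (norm_snd_le q) (norm_fst_le q)
  simpa [sub_eq_add_neg] using this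

theorem eventually_forall_rot {P : ℝ × ℝ → Prop} (h : ∀ᶠ q in 𝓝 0, P q) :
    ∀ᶠ q in 𝓝 (0 : ℝ × ℝ), ∀ t, P (rot t q) := by
  obtain ⟨δ, hδ, hball⟩ := Metric.eventually_nhds_iff_ball.1 h
  filter_upwards [Metric.ball_mem_nhds (0 : ℝ × ℝ) (half_pos hδ)] with q hq t
  refine hball _ ?_
  rw [mem_ball_zero_iff] at hq ⊢
  linarith [norm_rot_le t q]

theorem exists_rot_eq (q : ℝ × ℝ) : ∃ r θ : ℝ, q = rot θ (r, 0) := by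
  refine ⟨‖(⟨q.1, -q.2⟩ : ℂ)‖, Complex.arg ⟨q.1, -q.2⟩, ?_⟩
  have h1 := Complex.norm_mul_cos_arg ⟨q.1, -q.2⟩
  have h2 := Complex.norm_mul_sin_arg ⟨q.1, -q.2⟩
  simp only at h1 h2
  rw [rot_apply]
  ext <;> simp only <;> linarith

/-- The mean of `m` over the circle through `q`. -/
noncomputable def rotAvg (m : ℝ × ℝ → ℝ) (q : ℝ × ℝ) : ℝ :=
  ∫ t in (0 : ℝ)..2 * Real.pi, (2 * Real.pi)⁻¹ * m (rot t q)

theorem rotAvg_rot (m : ℝ × ℝ → ℝ) (s : ℝ) (q : ℝ × ℝ) : rotAvg m (rot s q) = rotAvg m q := by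
  unfold rotAvg
  simp only [← rot_add]
  rw [intervalIntegral.integral_comp_add_right (fun t => (2 * Real.pi)⁻¹ * m (rot t q))]
  have hper : Function.Periodic (fun t => (2 * Real.pi)⁻¹ * m (rot t q)) (2 * Real.pi) := by
    intro t
    simp only [rot_add_two_pi]
  have := hper.intervalIntegral_add_eq s 0
  rw [zero_add] at this ⊢
  rw [add_comm (2 * Real.pi) s, this]

theorem rotAvg_zero (m : ℝ × ℝ → ℝ) : rotAvg m 0 = m 0 := by
  have := Real.pi_pos
  simp only [rotAvg, map_zero, intervalIntegral.integral_const, smul_eq_mul]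
  field_simp
  ring

theorem analyticAt_rotAvg {m : ℝ × ℝ → ℝ} (hm : AnalyticAt ℝ m 0) : AnalyticAt ℝ (rotAvg m) 0 :=
  hm.intervalIntegral_comp_clm continuous_rot continuous_const Real.two_pi_pos.le

/-- The cohomological equation over the rotation flow: a function of mean zero on circles is a
derivative along the rotations, with the explicit analytic primitive `(2π)⁻¹ ∫ t m(ρ_t q) dt`. -/
theorem AnalyticAt.exists_rot_primitive {m : ℝ × ℝ → ℝ} (hm : AnalyticAt ℝ m 0) :
    ∃ ψ : ℝ × ℝ → ℝ, AnalyticAt ℝ ψ 0 ∧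
      ∀ᶠ q in 𝓝 (0 : ℝ × ℝ), HasDerivAt (fun s => ψ (rot s q)) (m q - rotAvg m q) 0 := by
  refine ⟨_, hm.intervalIntegral_comp_clm continuous_rot (k := fun t => (2 * Real.pi)⁻¹ * t)
    (by fun_prop) Real.two_pi_pos.le, ?_⟩
  filter_upwards [eventually_forall_rot hm.eventually_continuousAt] with q hq
  have hμ : Continuous fun t => m (rot t q) := continuous_iff_continuousAt.2 fun t =>
    ContinuousAt.comp (f := fun t => rot t q) (hq t) (hasDerivAt_rot q t).continuousAt
  have htμ : Continuous fun t => t * m (rot t q) := continuous_id.mul hμ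
  set M := ∫ t in (0 : ℝ)..2 * Real.pi, m (rot t q) with hM
  have hper : Function.Periodic (fun t => m (rot t q)) (2 * Real.pi) := fun t => by
    simp only [rot_add_two_pi]
  have hψ : (fun s => ∫ t in (0 : ℝ)..2 * Real.pi, (2 * Real.pi)⁻¹ * t * m (rot t (rot s q))) =
      fun s => (2 * Real.pi)⁻¹ * ((∫ t in (0 : ℝ)..s + 2 * Real.pi, t * m (rot t q)) -
        (∫ t in (0 : ℝ)..s, t * m (rot t q)) - s * M) := by
    ext s
    simp only [← rot_add, mul_assoc]
    rw [intervalIntegral.integral_const_mul]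
    congr 1
    have e1 : ∫ t in (0 : ℝ)..2 * Real.pi, t * m (rot (t + s) q) =
        ∫ t in (0 : ℝ)..2 * Real.pi, (fun t => (t - s) * m (rot t q)) (t + s) := by
      simp
    rw [e1, intervalIntegral.integral_comp_add_right (fun t => (t - s) * m (rot t q)), zero_add,
      add_comm (2 * Real.pi) s,
      intervalIntegral.integral_interval_sub_left (htμ.intervalIntegrable _ _)
        (htμ.intervalIntegrable _ _)]
    have e2 := hper.intervalIntegral_add_eq s 0
    rw [zero_add, ← hM] at e2
    have hsμ : Continuous fun t => s * m (rot t q) := continuous_const.mul hμ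
    rw [← e2, ← intervalIntegral.integral_const_mul, ← intervalIntegral.integral_sub
      (htμ.intervalIntegrable _ _) (hsμ.intervalIntegrable _ _)]
    simp only [sub_mul]
  rw [hψ]
  have hG : ∀ x, HasDerivAt (fun x => ∫ t in (0 : ℝ)..x, t * m (rot t q)) (x * m (rot x q)) x :=
    fun x => intervalIntegral.integral_hasDerivAt_right (htμ.intervalIntegrable _ _)
      (htμ.stronglyMeasurableAtFilter _ _) htμ.continuousAt
  have h1 : HasDerivAt (fun s : ℝ => ∫ t in (0 : ℝ)..s + 2 * Real.pi, t * m (rot t q))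
      ((0 + 2 * Real.pi) * m (rot (0 + 2 * Real.pi) q)) 0 :=
    (hG (0 + 2 * Real.pi)).comp_add_const 0 (2 * Real.pi)
  have h2 := ((h1.fun_sub (hG 0)).fun_sub ((hasDerivAt_id (0 : ℝ)).mul_const M)).const_mul
    ((2 * Real.pi)⁻¹)
  convert! h2 using 1
  rw [rot_add_two_pi, rot_zero, rotAvg, intervalIntegral.integral_const_mul, ← hM]
  have := Real.pi_pos
  field_simp
  ring

/-- Rotating each circle into itself by a variable angle replaces the angular speed `1 / m` by its
harmonic mean, which is constant on circles. -/
theorem AnalyticAt.exists_twist {m : ℝ × ℝ → ℝ} (hm : AnalyticAt ℝ m 0) (hm0 : m 0 ≠ 0) :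
    ∃ K : ℝ × ℝ → ℝ × ℝ, AnalyticAt ℝ K 0 ∧ K 0 = 0 ∧ (fderiv ℝ K 0).IsInvertible ∧
      (∀ q, rotAvg m (K q) = rotAvg m q) ∧
      ∀ᶠ q in 𝓝 (0 : ℝ × ℝ), rotAvg m q • fderiv ℝ K q (rotField q) = m q • rotField (K q) := by
  obtain ⟨ψ₀, hψ₀, hψd⟩ := hm.exists_rot_primitive
  have hA0 : rotAvg m 0 ≠ 0 := by rwa [rotAvg_zero]
  set ψ : ℝ × ℝ → ℝ := fun q => ψ₀ q / rotAvg m q with hψdef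
  have hψ : AnalyticAt ℝ ψ 0 := hψ₀.div (analyticAt_rotAvg hm) hA0
  set K : ℝ × ℝ → ℝ × ℝ := fun q => rot (ψ q) q with hKdef
  have hcos : AnalyticAt ℝ (fun q => Real.cos (ψ q)) 0 :=
    AnalyticAt.fun_comp (g := Real.cos) Real.analyticAt_cos hψ
  have hsin : AnalyticAt ℝ (fun q => Real.sin (ψ q)) 0 :=
    AnalyticAt.fun_comp (g := Real.sin) Real.analyticAt_sin hψ
  have hK : AnalyticAt ℝ K 0 :=
    (((hcos.mul analyticAt_fst).add (hsin.mul analyticAt_snd)).prod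
      ((hcos.mul analyticAt_snd).sub (hsin.mul analyticAt_fst))).congr
      (Eventually.of_forall fun q => (rot_apply (ψ q) q).symm)
  have hK0 : K 0 = 0 := map_zero _
  refine ⟨K, hK, hK0, ?_, fun q => rotAvg_rot m _ q, ?_⟩
  · have hKv : ∀ v, fderiv ℝ K 0 v = rot (ψ 0) v := by
      intro v
      have hl : HasDerivAt (fun s : ℝ => s • v) v 0 := by
        simpa using (hasDerivAt_id (0 : ℝ)).smul_const v
      have hz : (0 : ℝ) • v = 0 := zero_smul ℝ v
      have h1 : HasDerivAt (fun s : ℝ => K (s • v)) (fderiv ℝ K 0 v) 0 :=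
        HasFDerivAt.comp_hasDerivAt (l := K) (f := fun s : ℝ => s • v) (0 : ℝ)
          (by rw [hz]; exact hK.differentiableAt.hasFDerivAt) hl
      have h2 : HasDerivAt (fun s : ℝ => ψ (s • v)) (fderiv ℝ ψ 0 v) 0 :=
        HasFDerivAt.comp_hasDerivAt (l := ψ) (f := fun s : ℝ => s • v) (0 : ℝ)
          (by rw [hz]; exact hψ.differentiableAt.hasFDerivAt) hl
      have h3 : HasDerivAt (fun s : ℝ => rot (ψ (s • v)) v) _ 0 :=
        HasDerivAt.scomp (g₁ := fun t => rot t v) (0 : ℝ) (hasDerivAt_rot v _) h2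
      have h4 := (hasDerivAt_id (0 : ℝ)).fun_smul h3
      have h5 : (fun s : ℝ => K (s • v)) = fun s => id s • rot (ψ (s • v)) v := by
        ext s : 1
        simp only [hKdef, map_smul, id]
      rw [h5] at h1
      rw [h1.unique h4]
      simp
    refine ContinuousLinearMap.isInvertible_of_forall_eq_zero fun v hv => ?_
    rw [hKv] at hv
    have := rot_add (-ψ 0) (ψ 0) v
    rw [hv, map_zero, neg_add_cancel, rot_zero] at this
    exact this
  · filter_upwards [hψd, hK.eventually_hasFDerivAt,
      (analyticAt_rotAvg hm).continuousAt.eventually_ne hA0]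
      with q h1 h2 h3
    have hd : HasDerivAt (fun s => rot s q) (rotField q) 0 := by
      simpa [rot_zero] using hasDerivAt_rot q 0
    have h4 : HasDerivAt (fun s => K (rot s q)) (fderiv ℝ K q (rotField q)) 0 :=
      HasFDerivAt.comp_hasDerivAt (l := K) (f := fun s : ℝ => rot s q) (0 : ℝ)
        (by rw [rot_zero]; exact h2) hd
    have h5 : (fun s => K (rot s q)) = fun s => rot (ψ₀ (rot s q) / rotAvg m q + s) q := by
      ext s : 1
      simp only [hKdef, hψdef, rotAvg_rot, rot_add]
    have h6 := (h1.div_const (rotAvg m q)).fun_add (hasDerivAt_id (0 : ℝ))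
    have h7 : HasDerivAt (fun s : ℝ => rot (ψ₀ (rot s q) / rotAvg m q + s) q) _ 0 :=
      HasDerivAt.scomp (g₁ := fun t => rot t q) (0 : ℝ) (hasDerivAt_rot q _) h6
    rw [h5] at h4
    rw [h4.unique h7, smul_smul, add_zero, rot_zero]
    congr 1
    field_simp
    ring

/-! ### Analytic functions with prescribed circular means -/

/-- The mean of an even power `cos ^ k` is at least `1 / (k + 1)`, by the Wallis recursion. -/
theorem inv_le_mean_cos_pow (k : ℕ) :
    ((2 * k : ℕ) + 1 : ℝ)⁻¹ ≤
      ∫ t in (0 : ℝ)..2 * Real.pi, (2 * Real.pi)⁻¹ * Real.cos t ^ (2 * k) := by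
  induction k with
  | zero =>
    have := Real.pi_pos
    simp
    field_simp
    norm_num
  | succ k ih =>
    rw [intervalIntegral.integral_const_mul] at ih ⊢
    rw [show 2 * (k + 1) = 2 * k + 2 by ring, integral_cos_pow]
    simp only [Real.sin_two_pi, Real.sin_zero, mul_zero, sub_zero, zero_div, zero_add]
    rw [mul_left_comm]
    refine le_trans ?_ (mul_le_mul_of_nonneg_left ih (by positivity))
    push_cast
    have : (0 : ℝ) ≤ k := Nat.cast_nonneg k
    rw [div_mul_eq_mul_div, mul_inv_cancel₀ (by positivity), one_div]
    exact inv_anti₀ (by positivity) (by linarith)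

/-- Every analytic function that is constant on circles is the circular mean of an analytic function
of the first coordinate: dividing the even Taylor coefficients by the means of the powers of the
cosine keeps the radius of convergence positive. -/
theorem AnalyticAt.exists_rotAvg_fst_eq {m : ℝ × ℝ → ℝ} (hm : AnalyticAt ℝ m 0) :
    ∃ n : ℝ → ℝ, AnalyticAt ℝ n 0 ∧
      ∀ᶠ q in 𝓝 (0 : ℝ × ℝ), rotAvg (fun z => n z.1) q = rotAvg m q := by
  set α : ℝ → ℝ := fun r => rotAvg m (r, 0) with hαdef
  have hα : AnalyticAt ℝ α 0 :=
    AnalyticAt.fun_comp_of_eq (g := rotAvg m) (analyticAt_rotAvg hm)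
      (analyticAt_id.prod analyticAt_const) rfl
  have heven : ∀ r, α (-r) = α r := fun r => by
    have : rot Real.pi (r, 0) = (-r, 0) := by simp [rot_apply]
    simp only [hαdef]
    rw [← this, rotAvg_rot]
  obtain ⟨p, R, hp⟩ := hα
  obtain ⟨ρ, hρ0, hρ⟩ := ENNReal.lt_iff_exists_nnreal_btwn.1 hp.r_pos
  have hρ0' : (0 : ℝ) < ρ := by exact_mod_cast hρ0
  obtain ⟨K, hK0, hK⟩ := p.norm_mul_pow_le_of_lt_radius (hρ.trans_le hp.r_le)
  simp only [FormalMultilinearSeries.norm_apply_eq_norm_coef] at hK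
  set w : ℕ → ℝ := fun k => ∫ t in (0 : ℝ)..2 * Real.pi, (2 * Real.pi)⁻¹ * Real.cos t ^ k with hw
  set b : ℕ → ℝ := fun k => if Even k then p.coeff k / w k else 0 with hb
  have hwpos : ∀ k : ℕ, Even k → ((k : ℝ) + 1)⁻¹ ≤ w k := by
    rintro k hk
    obtain ⟨l, rfl⟩ := hk
    rw [← two_mul]
    exact inv_le_mean_cos_pow l
  have hbK : ∀ k, ‖b k‖ * (ρ / 2 : ℝ) ^ k ≤ K := by
    intro k
    by_cases hk : Even k
    · have h1 : ‖b k‖ ≤ ((k : ℝ) + 1) * ‖p.coeff k‖ := by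
        simp only [hb, hk, if_true]
        have h2 := hwpos k hk
        have h3 : 0 < w k := lt_of_lt_of_le (by positivity) h2
        rw [norm_div, Real.norm_of_nonneg h3.le, div_le_iff₀ h3]
        have h4 : 1 ≤ ((k : ℝ) + 1) * w k := by
          rw [inv_le_iff_one_le_mul₀ (by positivity)] at h2
          linarith
        nlinarith [norm_nonneg (p.coeff k)]
      have h3 : ((k : ℝ) + 1) ≤ 2 ^ k := by exact_mod_cast Nat.lt_two_pow_self (n := k)
      calc ‖b k‖ * (ρ / 2 : ℝ) ^ k ≤ (2 ^ k * ‖p.coeff k‖) * (ρ / 2 : ℝ) ^ k := by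
            gcongr
            exact h1.trans (mul_le_mul_of_nonneg_right h3 (norm_nonneg _))
        _ = ‖p.coeff k‖ * (ρ : ℝ) ^ k := by rw [div_pow]; field_simp
        _ ≤ K := hK k
    · simp [hb, hk, hK0.le]
  set P := FormalMultilinearSeries.ofScalars ℝ b with hP
  have hrad : ((ρ / 2 : NNReal) : ENNReal) ≤ P.radius := by
    refine P.le_radius_of_bound K fun k => ?_
    rw [hP, FormalMultilinearSeries.ofScalars_norm]
    simpa using hbK k
  have hpos : 0 < ((ρ / 2 : NNReal) : ENNReal) := by
    have : 0 < ρ / 2 := half_pos (by exact_mod_cast hρ0)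
    exact_mod_cast this
  have hPs := (P.hasFPowerSeriesOnBall (hpos.trans_le hrad)).mono hpos hrad
  have hsum : ∀ x : ℝ, |x| < ρ / 2 → HasSum (fun k => b k * x ^ k) (P.sum x) := by
    intro x hx
    have := hPs.hasSum (y := x) (by
      rw [Metric.eball_coe, mem_ball_zero_iff]; simpa using hx)
    simpa [hP, FormalMultilinearSeries.ofScalars_apply_eq, mul_comm] using this
  refine ⟨P.sum, hPs.analyticAt, ?_⟩
  have hρ4 : (0 : ℝ) < ρ / 4 := by positivity
  have hρ8 : (0 : ℝ) < ρ / 8 := by positivity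
  -- Both sides are constant on circles, so it suffices to compare them on the axis `v = 0`.
  have haxis : ∀ r : ℝ, |r| < ρ / 4 → rotAvg (fun z => P.sum z.1) (r, 0) = α r := by
    intro r hr
    have hrρ : ∀ t, |Real.cos t * r| < ρ / 2 := fun t => by
      rw [abs_mul]
      have := mul_le_of_le_one_left (abs_nonneg r) (Real.abs_cos_le_one t)
      linarith
    have hs1 : HasSum (fun k => ∫ t in (0 : ℝ)..2 * Real.pi,
        (2 * Real.pi)⁻¹ * (b k * (Real.cos t * r) ^ k))
        (∫ t in (0 : ℝ)..2 * Real.pi, (2 * Real.pi)⁻¹ * P.sum (Real.cos t * r)) := by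
      refine intervalIntegral.hasSum_integral_of_dominated_convergence
        (fun k _ => (2 * Real.pi)⁻¹ * (K * (1 / 2) ^ k)) (fun k => ?_) (fun k => ?_) ?_ ?_ ?_
      · exact Continuous.aestronglyMeasurable (by fun_prop)
      · refine Eventually.of_forall fun t _ => ?_
        have hpi := Real.pi_pos
        rw [norm_mul, norm_mul, norm_pow, Real.norm_of_nonneg (by positivity : 0 ≤ (2 * Real.pi)⁻¹)]
        refine mul_le_mul_of_nonneg_left ?_ (by positivity)
        have h1 : ‖Real.cos t * r‖ ≤ (ρ / 2) * (1 / 2) := by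
          rw [norm_mul]
          have := mul_le_of_le_one_left (abs_nonneg r) (Real.abs_cos_le_one t)
          simp only [Real.norm_eq_abs]
          linarith
        calc ‖b k‖ * ‖Real.cos t * r‖ ^ k ≤ ‖b k‖ * ((ρ / 2) * (1 / 2)) ^ k := by gcongr
          _ = (‖b k‖ * (ρ / 2 : ℝ) ^ k) * (1 / 2) ^ k := by rw [mul_pow]; ring
          _ ≤ K * (1 / 2) ^ k := by gcongr; exact hbK k
      · exact Eventually.of_forall fun t _ => (summable_geometric_two.mul_left K).mul_left _
      · exact intervalIntegrable_const
      · exact Eventually.of_forall fun t _ => (hsum _ (hrρ t)).mul_left _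
    have hα1 : ∀ x : ℝ, |x| < ρ → HasSum (fun k => p.coeff k * x ^ k) (α x) := by
      intro x hx
      have := hp.hasSum (y := x) (Metric.eball_subset_eball hρ.le (by
        rw [Metric.eball_coe, mem_ball_zero_iff]; simpa using hx))
      simpa [mul_comm] using this
    have h1 := hα1 r (by linarith)
    have h2 := hα1 (-r) (by rw [abs_neg]; linarith)
    rw [heven] at h2
    have h3 := (h1.add h2).mul_left (1 / 2)
    have h4 : (fun k => ∫ t in (0 : ℝ)..2 * Real.pi,
        (2 * Real.pi)⁻¹ * (b k * (Real.cos t * r) ^ k)) =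
        fun k => 1 / 2 * (p.coeff k * r ^ k + p.coeff k * (-r) ^ k) := by
      ext k
      have h5 : ∀ t, (2 * Real.pi)⁻¹ * (b k * (Real.cos t * r) ^ k) =
          (b k * r ^ k) * ((2 * Real.pi)⁻¹ * Real.cos t ^ k) := fun t => by
        rw [mul_pow]; ring
      simp only [h5]
      rw [intervalIntegral.integral_const_mul]
      by_cases hk : Even k
      · have hwk : w k ≠ 0 := (lt_of_lt_of_le (by positivity) (hwpos k hk)).ne'
        rw [hk.neg_pow]
        change b k * r ^ k * w k = _
        simp only [hb, hk, if_true]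
        field_simp
        ring
      · rw [(Nat.not_even_iff_odd.1 hk).neg_pow]
        simp [hb, hk]
    rw [h4] at hs1
    have h6 := hs1.unique h3
    have h7 : rotAvg (fun z => P.sum z.1) (r, 0) =
        ∫ t in (0 : ℝ)..2 * Real.pi, (2 * Real.pi)⁻¹ * P.sum (Real.cos t * r) := by
      simp [rotAvg, rot_apply]
    rw [h7, h6]
    ring
  filter_upwards [Metric.ball_mem_nhds (0 : ℝ × ℝ) hρ8] with q hq
  obtain ⟨r, θ, rfl⟩ := exists_rot_eq q
  rw [rotAvg_rot, rotAvg_rot]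
  refine haxis r ?_
  rw [mem_ball_zero_iff] at hq
  have h1 := norm_rot_le (-θ) (rot θ (r, 0))
  rw [← rot_add, neg_add_cancel, rot_zero] at h1
  have h2 := norm_fst_le ((r, 0) : ℝ × ℝ)
  simp only [Real.norm_eq_abs] at h2
  linarith

/-! ### Potential fields and the conjugacy -/

/-- The potential `V = E² / 2` with `E' = 1 / n(E)`: the map `(x, y) ↦ (E(x), y)` takes the
potential field of `V` to `1 / n` times the rotation field. -/
theorem AnalyticAt.exists_potential {n : ℝ → ℝ} (hn : AnalyticAt ℝ n 0) (hn0 : n 0 ≠ 0) :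
    ∃ (V : ℝ → ℝ) (H : ℝ × ℝ → ℝ × ℝ), AnalyticAt ℝ V 0 ∧ V 0 = 0 ∧ deriv V 0 = 0 ∧
      0 < deriv (deriv V) 0 ∧ AnalyticAt ℝ H 0 ∧ H 0 = 0 ∧ (fderiv ℝ H 0).IsInvertible ∧
      ∀ᶠ z in 𝓝 (0 : ℝ × ℝ), n (H z).1 • fderiv ℝ H z (potentialField V z) = rotField (H z) := by
  have hF : AnalyticAt ℝ (fun q : ℝ × ℝ => (n q.2)⁻¹) 0 :=
    (AnalyticAt.fun_comp_of_eq hn analyticAt_snd rfl).inv hn0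
  obtain ⟨φ, hφ, hφ0, hφd⟩ := hF.exists_flow
  set E : ℝ → ℝ := fun x => φ (x, 0) with hEdef
  have hE : AnalyticAt ℝ E 0 :=
    AnalyticAt.fun_comp_of_eq (g := φ) hφ (analyticAt_id.prod analyticAt_const) rfl
  have hE0 : E 0 = 0 := hφ0.self_of_nhds
  have hax : Tendsto (fun x : ℝ => (x, (0 : ℝ))) (𝓝 0) (𝓝 0) := by
    have : Continuous fun x : ℝ => (x, (0 : ℝ)) := by fun_prop
    exact this.tendsto' 0 0 rfl
  have hEd : ∀ᶠ x in 𝓝 (0 : ℝ), HasDerivAt E (n (E x))⁻¹ x := hax.eventually hφd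
  have hE0d : HasDerivAt E (n 0)⁻¹ 0 := by
    have := hEd.self_of_nhds
    rwa [hE0] at this
  have hVd : ∀ᶠ x in 𝓝 (0 : ℝ), HasDerivAt (fun x => E x ^ 2 / 2) (E x * (n (E x))⁻¹) x := by
    filter_upwards [hEd] with x hx
    have := (hx.fun_pow 2).div_const 2
    convert! this using 1
    simp
    ring
  have hVd' : deriv (fun x => E x ^ 2 / 2) =ᶠ[𝓝 0] fun x => E x * (n (E x))⁻¹ :=
    hVd.mono fun x hx => hx.deriv
  have hnE : AnalyticAt ℝ (fun x => (n (E x))⁻¹) 0 :=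
    (AnalyticAt.fun_comp_of_eq hn hE hE0).inv (by rwa [hE0])
  have hfst : Tendsto (fun z : ℝ × ℝ => z.1) (𝓝 0) (𝓝 0) := continuous_fst.tendsto' _ _ rfl
  have hHd : ∀ x : ℝ × ℝ, HasDerivAt E (n (E x.1))⁻¹ x.1 → ∀ v,
      fderiv ℝ (fun z : ℝ × ℝ => (E z.1, z.2)) x v = ((n (E x.1))⁻¹ * v.1, v.2) := by
    intro x hx v
    have h3 : HasFDerivAt (fun z : ℝ × ℝ => E z.1) _ x :=
      HasFDerivAt.comp (g := E) x hx.hasFDerivAt hasFDerivAt_fst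
    rw [(h3.prodMk hasFDerivAt_snd).fderiv]
    simp [mul_comm]
  refine ⟨fun x => E x ^ 2 / 2, fun z => (E z.1, z.2), ?_, ?_, ?_, ?_, ?_, ?_, ?_, ?_⟩
  · exact (hE.pow 2).div analyticAt_const two_ne_zero
  · simp [hE0]
  · rw [hVd'.self_of_nhds]
    simp [hE0]
  · rw [hVd'.deriv_eq]
    have := (hE0d.fun_mul hnE.differentiableAt.hasDerivAt).deriv
    rw [this, hE0]
    have h2 : 0 < (n 0)⁻¹ * (n 0)⁻¹ := mul_self_pos.2 (inv_ne_zero hn0)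
    simpa using h2
  · exact (AnalyticAt.fun_comp_of_eq hE analyticAt_fst rfl).prod analyticAt_snd
  · simp only [Prod.fst_zero, Prod.snd_zero, hE0]
    rfl
  · refine ContinuousLinearMap.isInvertible_of_forall_eq_zero fun v hv => ?_
    rw [hHd 0 hEd.self_of_nhds] at hv
    have h1 := congrArg Prod.fst hv
    have h2 := congrArg Prod.snd hv
    simp only [Prod.fst_zero, hE0, mul_eq_zero, inv_eq_zero, hn0, false_or] at h1
    exact Prod.ext h1 h2
  · have hne : ∀ᶠ x in 𝓝 (0 : ℝ), n (E x) ≠ 0 := by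
      have h1 : ContinuousAt (fun x => n (E x)) 0 :=
        (AnalyticAt.fun_comp_of_eq hn hE hE0).continuousAt
      exact h1.eventually_ne (by rwa [hE0])
    filter_upwards [hfst.eventually hEd, hfst.eventually hVd', hfst.eventually hne] with z h1 h2 h3
    rw [hHd z h1]
    simp only [potentialField, rotField, h2]
    ext
    · simp only [Prod.smul_fst, smul_eq_mul]
      field_simp
    · simp only [Prod.smul_snd, smul_eq_mul]
      field_simp

/-- A field that becomes `1 / m` times the rotation field after the change of coordinates `H`
becomes `1 / rotAvg m` times the rotation field after a further twist. -/
theorem exists_circular_normal_form {X H : ℝ × ℝ → ℝ × ℝ} {m : ℝ × ℝ → ℝ}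
    (hH : AnalyticAt ℝ H 0) (hH0 : H 0 = 0) (hHi : (fderiv ℝ H 0).IsInvertible)
    (hm : AnalyticAt ℝ m 0) (hm0 : m 0 ≠ 0)
    (hX : ∀ᶠ z in 𝓝 (0 : ℝ × ℝ), m (H z) • fderiv ℝ H z (X z) = rotField (H z)) :
    ∃ K : ℝ × ℝ → ℝ × ℝ, AnalyticAt ℝ K 0 ∧ K 0 = 0 ∧ (fderiv ℝ K 0).IsInvertible ∧
      ∀ᶠ z in 𝓝 (0 : ℝ × ℝ), fderiv ℝ K z (X z) = (rotAvg m (K z))⁻¹ • rotField (K z) := by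
  obtain ⟨T, hT, hT0, hTi, hTavg, hTd⟩ := hm.exists_twist hm0
  have hA0 : rotAvg m 0 ≠ 0 := by rwa [rotAvg_zero]
  have hHt : Tendsto H (𝓝 0) (𝓝 0) := by
    have := hH.continuousAt.tendsto
    rwa [hH0] at this
  have hcomp : ∀ᶠ z in 𝓝 (0 : ℝ × ℝ),
      fderiv ℝ (fun z => T (H z)) z = (fderiv ℝ T (H z)).comp (fderiv ℝ H z) := by
    filter_upwards [hH.eventually_hasFDerivAt, hHt.eventually hT.eventually_hasFDerivAt]
      with z h1 h2
    exact (h2.comp z h1).fderiv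
  refine ⟨fun z => T (H z), AnalyticAt.fun_comp_of_eq hT hH hH0, by simp [hH0, hT0], ?_, ?_⟩
  · rw [hcomp.self_of_nhds, hH0]
    exact hTi.comp hHi
  · filter_upwards [hcomp, hX, hHt.eventually hTd,
      hHt.eventually (hm.continuousAt.eventually_ne hm0),
      hHt.eventually ((analyticAt_rotAvg hm).continuousAt.eventually_ne hA0)] with z h1 h2 h3 h4 h5
    rw [h1, hTavg, ContinuousLinearMap.comp_apply]
    rw [← h2, map_smul, smul_smul, mul_comm, ← smul_smul] at h3
    have h6 := smul_right_injective (ℝ × ℝ) h4 h3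
    rw [← h6, smul_smul, inv_mul_cancel₀ h5, one_smul]

theorem mainTheorem2 (Ω : Set (ℝ × ℝ)) (hΩ : IsOpen Ω) (h0 : (0, 0) ∈ Ω)
    (X : ℝ × ℝ → ℝ × ℝ) (hX : AnalyticOnNhd ℝ X Ω) (hX0 : X (0, 0) = (0, 0))
    (hdet : 0 < jacobianDet X (0, 0)) (hrev : IsReversibleOn reflectionR X Ω) :
    ∃ (I : Set ℝ) (V : ℝ → ℝ), IsOpen I ∧ 0 ∈ I ∧ AnalyticOnNhd ℝ V I ∧
      V 0 = 0 ∧ deriv V 0 = 0 ∧ 0 < deriv (deriv V) 0 ∧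
      AnalyticallyConjugateNearZero X Ω (potentialField V) (I ×ˢ univ) := by
  have hΩn : Ω ∈ 𝓝 (0 : ℝ × ℝ) := hΩ.mem_nhds h0
  have hXa : AnalyticAt ℝ X 0 := hX _ h0
  obtain ⟨p, q, hp, hq, hpq⟩ := hrev.exists_fold hΩn hXa
  have hq0 : q 0 = 0 := by
    have h1 := hpq.self_of_nhds
    have h2 := congrArg Prod.snd ((show X 0 = (0, 0) from hX0).symm.trans h1)
    have hz : ((0 : ℝ × ℝ).1, (0 : ℝ × ℝ).2 ^ 2) = 0 := by ext <;> simp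
    simp only [hz] at h2
    exact h2.symm
  have hXd : fderiv ℝ X 0 = (p 0 • ContinuousLinearMap.snd ℝ ℝ ℝ).prod
      (fderiv ℝ q 0 (1, 0) • ContinuousLinearMap.fst ℝ ℝ ℝ) := by
    rw [Filter.EventuallyEq.fderiv_eq (f₁ := X) hpq]
    have hfold : HasFDerivAt (fun z : ℝ × ℝ => (z.1, z.2 ^ 2)) _ 0 :=
      (hasFDerivAt_fst (𝕜 := ℝ) (p := (0 : ℝ × ℝ))).prodMk
        ((hasFDerivAt_snd (𝕜 := ℝ) (p := (0 : ℝ × ℝ))).pow 2)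
    have hz : ((0 : ℝ × ℝ).1, (0 : ℝ × ℝ).2 ^ 2) = 0 := by ext <;> simp
    have h1 : HasFDerivAt (fun z : ℝ × ℝ => p (z.1, z.2 ^ 2)) _ 0 :=
      HasFDerivAt.comp (0 : ℝ × ℝ) (g := p) (by rw [hz]; exact hp.differentiableAt.hasFDerivAt)
        hfold
    have h2 : HasFDerivAt (fun z : ℝ × ℝ => q (z.1, z.2 ^ 2)) _ 0 :=
      HasFDerivAt.comp (0 : ℝ × ℝ) (g := q) (by rw [hz]; exact hq.differentiableAt.hasFDerivAt)
        hfold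
    rw [(((hasFDerivAt_snd (𝕜 := ℝ) (p := (0 : ℝ × ℝ))).fun_mul h1).prodMk h2).fderiv]
    rw [hz]
    ext <;> simp
    exact map_zero (fderiv ℝ q 0)
  have hsign : p 0 * fderiv ℝ q 0 (1, 0) < 0 := by
    have h1 : 0 < jacobianDet X 0 := hdet
    rw [jacobianDet, hXd] at h1
    simpa using h1
  obtain ⟨H, m, hH, hH0, hHi, hm, hm0, hHX⟩ := exists_orbital_normal_form hp hq hq0 hsign hpq
  obtain ⟨n, hn, hnm⟩ := hm.exists_rotAvg_fst_eq
  have hn0 : n 0 ≠ 0 := by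
    have := hnm.self_of_nhds
    rw [rotAvg_zero, rotAvg_zero] at this
    exact fun h => hm0 (this.symm.trans h)
  obtain ⟨V, G, hV, hV0, hV1, hV2, hG, hG0, hGi, hGY⟩ := hn.exists_potential hn0
  have hnf : AnalyticAt ℝ (fun z : ℝ × ℝ => n z.1) 0 :=
    AnalyticAt.fun_comp_of_eq hn analyticAt_fst rfl
  obtain ⟨K₁, hK₁, hK₁0, hK₁i, hK₁X⟩ := exists_circular_normal_form hH hH0 hHi hm hm0 hHX
  obtain ⟨K₂, hK₂, hK₂0, hK₂i, hK₂Y⟩ := exists_circular_normal_form hG hG0 hGi hnf hn0 hGY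
  have hI : IsOpen {x | AnalyticAt ℝ V x} := isOpen_analyticAt ℝ V
  refine ⟨{x | AnalyticAt ℝ V x}, V, hI, hV, fun x hx => hx, hV0, hV1, hV2, ?_⟩
  refine analyticallyConjugateNearZero_of_common (Z := fun z => (rotAvg m z)⁻¹ • rotField z) hΩn
    ((hI.prod isOpen_univ).mem_nhds ⟨hV, mem_univ _⟩) hK₁ hK₂ hK₁0 hK₂0 hK₁i hK₂i hK₁X ?_
  have hK₂t : Tendsto K₂ (𝓝 0) (𝓝 0) := by
    have := hK₂.continuousAt.tendsto
    rwa [hK₂0] at this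
  filter_upwards [hK₂Y, hK₂t.eventually hnm] with z h1 h2
  rw [h1, h2]
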